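/- Let $X$ be a compact metric space and $f:X\to X$ a continuous map. Let $\mathcal M(f)$ be the set of $f$-invariant Borel probability measures with the weak-$*$ topology, $\mathcal M_e(f)$ the subset of ergodic ones, $h_\mu(f)\in[0,\infty]$ the metric entropy, and $C(X)$ the space of continuous functions $X\to\mathbb R$ with the supremum norm. For $\phi\in C(X)$ let $P(\phi)$ be the topological pressure of $(X,f,\phi)$, let $P_\mu(\phi):=h_\mu(f)+\int\phi\,d\mu$, and let $\mathcal E(\phi):=\{\mu\in\mathcal M(f):P_\mu(\phi)=P(\phi)\}$ be the set of equilibrium states of $\phi$. Assume that the entropy map $\mu\mapsto h_\mu(f)$ is upper semi-continuous on $\mathcal M(f)$. (1) Let $\psi\in C(X)$, and let $\mathcal V(f,\psi)$ be the set of all $\phi\in C(X)$ such that $P_\mu(\psi)$ has the same value, denoted by $P^\psi(\phi)$, for all $\mu\in\mathcal E(\phi)$. Let $T\ge 0$ and let $\Phi:[0,T]\to\mathcal V(f,\psi)$ be a continuous path with $P^\psi(\Phi(0))<P^\psi(\Phi(T))$. Then $$\{P_\mu(\psi):\mu\in\mathcal M_e(f)\}\supset[P^\psi(\Phi(0)),P^\psi(\Phi(T))].$$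 (2) Let $T\ge 0$ and let $\Phi:[0,T]\to C(X)$ be a continuous path such that $\Phi(t)$ has a unique equilibrium state $\mu_t$ for every $t\in[0,T]$. If $h_{\mu_0}(f)\le h_{\mu_T}(f)$, then $$\{h_\mu(f):\mu\in\mathcal M_e(f)\}\supset[h_{\mu_0}(f),h_{\mu_T}(f)].$$ -/

import Mathlib

noncomputable section

namespace Thermo

open MeasureTheory Filter

/-! ### Measure-theoretic entropy -/

section Entropy

variable {X : Type*} [MeasurableSpace X]

/-- The set `M(f)` of `f`-invariant probability measures. -/
def invariantMeasures (f : X → X) : Set (ProbabilityMeasure X) :=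
  {μ | MeasurePreserving f (μ : Measure X) (μ : Measure X)}

/-- The set `M_e(f)` of ergodic `f`-invariant probability measures. -/
def ergodicMeasures (f : X → X) : Set (ProbabilityMeasure X) :=
  {μ | Ergodic f (μ : Measure X)}

/-- The Shannon entropy `-∑ μ(A) log μ(A)` of the finite partition of `X` into the fibres of a
labelling `ξ : X → ι`. -/
def partitionEntropy {ι : Type*} [Fintype ι] (μ : ProbabilityMeasure X) (ξ : X → ι) : ℝ :=
  ∑ i, Real.negMulLog ((μ : Measure X).real (ξ ⁻¹' {i}))

/-- The labelling of the joined partition `ξ ∨ f⁻¹ ξ ∨ ⋯ ∨ f^{-(n-1)} ξ`: a point is labelled by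
its `ξ`-itinerary of length `n`. -/
def itinerary {ι : Type*} (f : X → X) (ξ : X → ι) (n : ℕ) (x : X) : Fin n → ι :=
  fun j => ξ (f^[j] x)

/-- The entropy `h_μ(f, ξ)` of `f` relative to a finite partition, as the upper limit of
`H_μ(ξ ∨ ⋯ ∨ f^{-(n-1)} ξ) / n` (for an invariant `μ` the limit exists). -/
def entropyOfPartition {ι : Type*} [Fintype ι] (f : X → X) (μ : ProbabilityMeasure X)
    (ξ : X → ι) : EReal :=
  limsup (fun n : ℕ => ((partitionEntropy μ (itinerary f ξ n) / n : ℝ) : EReal)) atTop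

/-- The metric entropy `h_μ(f)`, with values in `[0, ∞]`: the supremum of `h_μ(f, ξ)` over all
finite measurable partitions `ξ`. -/
def metricEntropy (f : X → X) (μ : ProbabilityMeasure X) : EReal :=
  ⨆ (k : ℕ) (ξ : X → Fin k) (_ : Measurable ξ), entropyOfPartition f μ ξ

/-- The set `{h_μ(f) : μ ergodic}`. -/
def entropySpectrum (f : X → X) : Set EReal :=
  metricEntropy f '' ergodicMeasures f

end Entropy

/-! ### Topological pressure -/

section Pressure

variable {X : Type*} [MetricSpace X]

/-- `F` is `(n, ε)`-separated: distinct points of `F` are more than `ε` apart in the Bowen metric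
`d_n(x, y) = max_{0 ≤ j < n} d(f^j x, f^j y)`. -/
def IsSeparated (f : X → X) (n : ℕ) (ε : ℝ) (F : Finset X) : Prop :=
  ∀ x ∈ F, ∀ y ∈ F, x ≠ y → ∃ j < n, ε < dist (f^[j] x) (f^[j] y)

/-- The supremum of `∑_{x ∈ F} exp (φ(x) + φ(f x) + ⋯ + φ(f^{n-1} x))` over all finite
`(n, ε)`-separated sets `F`. -/
def separatedSum (f : X → X) (φ : C(X, ℝ)) (n : ℕ) (ε : ℝ) : ENNReal :=
  ⨆ (F : Finset X) (_ : IsSeparated f n ε F),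
    ∑ x ∈ F, ENNReal.ofReal (Real.exp (birkhoffSum f φ n x))

/-- The topological pressure `P(φ)`: the limit as `ε → 0` (equivalently, by monotonicity, the
supremum over `ε > 0`) of the exponential growth rate of `separatedSum f φ n ε`. -/
def topPressure (f : X → X) (φ : C(X, ℝ)) : EReal :=
  ⨆ (ε : ℝ) (_ : 0 < ε),
    limsup (fun n : ℕ => ENNReal.log (separatedSum f φ n ε) / (n : EReal)) atTop

end Pressure

/-! ### Equilibrium states -/

section Equilibrium

variable {X : Type*} [MetricSpace X] [MeasurableSpace X]

/-- The pressure `P_μ(φ) = h_μ(f) + ∫ φ dμ` of a measure. -/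
def measurePressure (f : X → X) (φ : C(X, ℝ)) (μ : ProbabilityMeasure X) : EReal :=
  metricEntropy f μ + ((∫ x, φ x ∂(μ : Measure X) : ℝ) : EReal)

/-- The set `{P_μ(φ) : μ ergodic}`. -/
def pressureSpectrum (f : X → X) (φ : C(X, ℝ)) : Set EReal :=
  measurePressure f φ '' ergodicMeasures f

/-- The set `E(φ)` of equilibrium states of `φ`. -/
def equilibriumStates (f : X → X) (φ : C(X, ℝ)) : Set (ProbabilityMeasure X) :=
  {μ | μ ∈ invariantMeasures f ∧ measurePressure f φ μ = topPressure f φ}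

/-- The set `U(f)` of potentials having a unique equilibrium state. -/
def uniqueEquilibrium (f : X → X) : Set C(X, ℝ) :=
  {φ | ∃! μ, μ ∈ equilibriumStates f φ}

/-- The set `V(f, ψ)` of potentials `φ` such that `P_μ(ψ)` takes the same value for all
equilibrium states `μ` of `φ`. -/
def constPressure (f : X → X) (ψ : C(X, ℝ)) : Set C(X, ℝ) :=
  {φ | ∃ c : EReal, ∀ μ ∈ equilibriumStates f φ, measurePressure f ψ μ = c}

/-- The common value `P^ψ(φ)` of `P_μ(ψ)` over the equilibrium states `μ` of `φ`, for `φ` in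
`V(f, ψ)`; it is written as a supremum so as to be defined for every `φ`, and
`constPressureValue_eq` below shows that it is that value. -/
def constPressureValue (f : X → X) (ψ φ : C(X, ℝ)) : EReal :=
  ⨆ μ ∈ equilibriumStates f φ, measurePressure f ψ μ

theorem constPressureValue_eq {f : X → X} {ψ φ : C(X, ℝ)} (hφ : φ ∈ constPressure f ψ)
    {μ : ProbabilityMeasure X} (hμ : μ ∈ equilibriumStates f φ) :
    constPressureValue f ψ φ = measurePressure f ψ μ := by
  obtain ⟨c, hc⟩ := hφ
  rw [hc μ hμ]
  exact le_antisymm (iSup₂_le fun ν hν => (hc ν hν).le) (le_iSup₂_of_le μ hμ (hc μ hμ).ge)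

/-- The entropy map `μ ↦ h_μ(f)` is upper semi-continuous on the space `M(f)` of invariant
probability measures, with the weak-* topology. -/
def IsUSCSystem [OpensMeasurableSpace X] (f : X → X) : Prop :=
  UpperSemicontinuousOn (metricEntropy f) (invariantMeasures f)

end Equilibrium

end Thermo

end

/-! Compactness and upper semi-continuity give every potential an equilibrium state as soon as there
is an invariant measure, and make weak-* limits of equilibrium states of convergent potentials
equilibrium states of the limit potential (`le_measurePressure_of_tendsto`). Entropy itself is only
upper semi-continuous, but an equilibrium state of `φ` with finite pressure has entropy `P(φ) - ∫ φ
dμ`, so that `P_μ(ψ) = P(φ) - ∫ φ dμ + ∫ ψ dμ`, and the right side is continuous jointly in `φ` and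
`μ`. Since `P_μ(ψ)` is constant on each `E(Φ t)`, the value `P^ψ(Φ t)` is continuous in `t`, however
the equilibrium states are chosen, and takes every intermediate value `α`.

An ergodic measure with value `α` comes from convexity. Entropy is convex in the measure, because
finite partition entropies are so up to a constant that disappears after division by `n`. Hence `E(Φ
t)` is a face of `M(f)`; it is compact, so it has an extreme point, and that point is ergodic
(`exists_ergodic_equilibriumState`).

The second part is the case `ψ = 0`, except when the two entropies agree; then uniqueness alone
makes `μ 0` ergodic, even if its entropy is infinite.

All this rests on the variational principle. Its upper half (`measurePressure_le_topPressure`) is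
Gibbs' inequality for itineraries, with a potential that penalises visits to a small bad set. Its
lower half (`exists_le_measurePressure`) is Misiurewicz's construction of a measure from Gibbs
weights on separated sets. -/

namespace Thermo

open MeasureTheory Filter Topology Real

/-! ### Shannon entropy of finite partitions -/

section PartitionEntropy

theorem negMulLog_sum_le {ι : Type*} (s : Finset ι) (a : ι → ℝ) (ha : ∀ i ∈ s, 0 ≤ a i) :
    negMulLog (∑ i ∈ s, a i) ≤ ∑ i ∈ s, negMulLog (a i) := by
  unfold negMulLog
  rw [← Finset.sum_neg_distrib, Finset.sum_mul]
  refine Finset.sum_le_sum fun i hi => ?_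
  rcases (ha i hi).eq_or_lt with h | h
  · simp [← h]
  · have : log (a i) ≤ log (∑ i ∈ s, a i) :=
      log_le_log h (Finset.single_le_sum ha hi)
    nlinarith

/-- Gibbs' inequality for finite probability vectors. -/
theorem sum_negMulLog_add_mul_log_le {ι : Type*} [Fintype ι] (p u : ι → ℝ) (hp : ∀ i, 0 ≤ p i)
    (hp1 : ∑ i, p i = 1) (hu : ∀ i, 0 ≤ u i) (hpu : ∀ i, p i ≠ 0 → u i ≠ 0) :
    ∑ i, (negMulLog (p i) + p i * log (u i)) ≤ log (∑ i, u i) := by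
  set Z := ∑ i, u i with hZ
  have hZ0 : 0 < Z := by
    obtain ⟨i, -, hi⟩ := Finset.exists_ne_zero_of_sum_ne_zero (hp1.trans_ne one_ne_zero)
    exact ((hu i).lt_of_ne (hpu i hi).symm).trans_le
      (Finset.single_le_sum (fun j _ => hu j) (Finset.mem_univ i))
  -- This is `log x ≤ x - 1` at `x = u i / (Z * p i)`, multiplied by `p i`.
  have key : ∀ i, negMulLog (p i) + p i * log (u i) ≤ p i * log Z + (u i / Z - p i) := by
    intro i
    rcases (hp i).eq_or_lt with h | h
    · simp only [← h, negMulLog_zero, zero_mul, zero_add, sub_zero]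
      exact div_nonneg (hu i) hZ0.le
    · have hui : 0 < u i := (hu i).lt_of_ne (hpu i h.ne').symm
      have h1 := log_le_sub_one_of_pos (div_pos (div_pos hui hZ0) h)
      rw [log_div (div_pos hui hZ0).ne' h.ne', log_div hui.ne' hZ0.ne'] at h1
      have h2 := mul_le_mul_of_nonneg_left h1 h.le
      have h3 : p i * (u i / Z / p i - 1) = u i / Z - p i := by field_simp
      rw [h3] at h2
      unfold negMulLog
      nlinarith
  calc _ ≤ ∑ i, (p i * log Z + (u i / Z - p i)) := Finset.sum_le_sum fun i _ => key i
    _ = log Z := by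
      rw [Finset.sum_add_distrib, Finset.sum_sub_distrib, ← Finset.sum_mul, ← Finset.sum_div, hp1,
        ← hZ, div_self hZ0.ne']
      ring

variable {X : Type*} [MeasurableSpace X] (μ : ProbabilityMeasure X)
variable {ι κ : Type*} [Fintype κ]

theorem real_preimage_eq_sum [MeasurableSpace κ] [MeasurableSingletonClass κ] [DecidableEq ι]
    {ζ : X → κ} (hζ : Measurable ζ) (g : κ → ι) (i : ι) :
    (μ : Measure X).real ((g ∘ ζ) ⁻¹' {i}) =
      ∑ j with g j = i, (μ : Measure X).real (ζ ⁻¹' {j}) := by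
  rw [sum_measureReal_preimage_singleton _ fun j _ => hζ (measurableSet_singleton j)]
  congr 1
  ext x
  simp

theorem sum_real_preimage_singleton [MeasurableSpace κ] [MeasurableSingletonClass κ]
    {ζ : X → κ} (hζ : Measurable ζ) : ∑ j, (μ : Measure X).real (ζ ⁻¹' {j}) = 1 := by
  rw [sum_measureReal_preimage_singleton _ fun j _ => hζ (measurableSet_singleton j)]
  simp

theorem measurable_itinerary [MeasurableSpace ι] {f : X → X} (hf : Measurable f) {ξ : X → ι}
    (hξ : Measurable ξ) (n : ℕ) : Measurable (itinerary f ξ n) :=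
  measurable_pi_lambda _ fun j => hξ.comp (hf.iterate j)

variable [Fintype ι]

theorem partitionEntropy_nonneg (ξ : X → ι) : 0 ≤ partitionEntropy μ ξ :=
  Finset.sum_nonneg fun _ _ => negMulLog_nonneg measureReal_nonneg measureReal_le_one

theorem partitionEntropy_comp_le [MeasurableSpace κ] [MeasurableSingletonClass κ]
    {ζ : X → κ} (hζ : Measurable ζ) (g : κ → ι) :
    partitionEntropy μ (g ∘ ζ) ≤ partitionEntropy μ ζ := by
  classical
  unfold partitionEntropy
  rw [← Finset.sum_fiberwise (s := Finset.univ) (g := g)]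
  refine Finset.sum_le_sum fun i _ => ?_
  rw [real_preimage_eq_sum μ hζ]
  exact negMulLog_sum_le _ _ fun _ _ => measureReal_nonneg

/-- A coarser labelling has smaller entropy. -/
theorem partitionEntropy_mono [MeasurableSpace κ] [MeasurableSingletonClass κ]
    {ξ : X → ι} {ζ : X → κ} (hζ : Measurable ζ) (h : ∀ x y, ζ x = ζ y → ξ x = ξ y) :
    partitionEntropy μ ξ ≤ partitionEntropy μ ζ := by
  have : Nonempty ι := μ.nonempty.map ξ
  obtain ⟨g, rfl⟩ := (Function.factorsThrough_iff ξ).1 (fun x y hxy => h x y hxy)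
  exact partitionEntropy_comp_le μ hζ g

theorem partitionEntropy_le_log_card [MeasurableSpace ι] [MeasurableSingletonClass ι]
    {ξ : X → ι} (hξ : Measurable ξ) : partitionEntropy μ ξ ≤ log (Fintype.card ι) := by
  have := sum_negMulLog_add_mul_log_le (fun i => (μ : Measure X).real (ξ ⁻¹' {i})) (fun _ => 1)
    (fun _ => measureReal_nonneg) (sum_real_preimage_singleton μ hξ) (fun _ => zero_le_one)
    (fun _ _ => one_ne_zero)
  simpa [partitionEntropy] using this

/-- Subadditivity is Gibbs' inequality for the joint distribution `r` against the product `p i * q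
j` of its marginals, whose total mass is `1`. -/
theorem partitionEntropy_prodMk_le [MeasurableSpace ι] [MeasurableSingletonClass ι]
    [MeasurableSpace κ] [MeasurableSingletonClass κ] {ξ : X → ι} {ζ : X → κ}
    (hξ : Measurable ξ) (hζ : Measurable ζ) :
    partitionEntropy μ (fun x => (ξ x, ζ x)) ≤ partitionEntropy μ ξ + partitionEntropy μ ζ := by
  classical
  have hm : Measurable fun x => (ξ x, ζ x) := hξ.prodMk hζ
  set r : ι × κ → ℝ := fun ij => (μ : Measure X).real ((fun x => (ξ x, ζ x)) ⁻¹' {ij}) with hr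
  set p : ι → ℝ := fun i => (μ : Measure X).real (ξ ⁻¹' {i}) with hp
  set q : κ → ℝ := fun j => (μ : Measure X).real (ζ ⁻¹' {j}) with hq
  have hr0 : ∀ ij, 0 ≤ r ij := fun _ => measureReal_nonneg
  have hp0 : ∀ i, 0 ≤ p i := fun _ => measureReal_nonneg
  have hq0 : ∀ i, 0 ≤ q i := fun _ => measureReal_nonneg
  have hrp : ∀ i j, r (i, j) ≤ p i := fun i j =>
    measureReal_mono (fun x hx => by simp_all)
  have hrq : ∀ i j, r (i, j) ≤ q j := fun i j =>
    measureReal_mono (fun x hx => by simp_all)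
  have hsp : ∀ i, ∑ j, r (i, j) = p i := by
    intro i
    have := real_preimage_eq_sum μ hm Prod.fst i
    rw [show (Prod.fst ∘ fun x => (ξ x, ζ x)) = ξ from rfl] at this
    rw [hp]
    simp only
    rw [this, Finset.sum_filter, Fintype.sum_prod_type_right]
    simp [hr]
  have hsq : ∀ j, ∑ i, r (i, j) = q j := by
    intro j
    have := real_preimage_eq_sum μ hm Prod.snd j
    rw [show (Prod.snd ∘ fun x => (ξ x, ζ x)) = ζ from rfl] at this
    rw [hq]
    simp only
    rw [this, Finset.sum_filter, Fintype.sum_prod_type]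
    simp [hr]
  have hne : ∀ i j, r (i, j) ≠ 0 → p i ≠ 0 ∧ q j ≠ 0 := fun i j h =>
    have h0 := (hr0 (i, j)).lt_of_ne h.symm
    ⟨(h0.trans_le (hrp i j)).ne', (h0.trans_le (hrq i j)).ne'⟩
  have key := sum_negMulLog_add_mul_log_le r (fun ij => p ij.1 * q ij.2) hr0
    (sum_real_preimage_singleton μ hm) (fun ij => mul_nonneg (hp0 _) (hq0 _))
    (fun ij h => mul_ne_zero (hne _ _ h).1 (hne _ _ h).2)
  have hone : ∑ ij : ι × κ, p ij.1 * q ij.2 = 1 := by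
    rw [Fintype.sum_prod_type]
    simp only [← Finset.mul_sum]
    rw [sum_real_preimage_singleton μ hζ]
    simp only [mul_one]
    exact sum_real_preimage_singleton μ hξ
  have hlog : ∀ ij : ι × κ, r ij * log (p ij.1 * q ij.2)
      = r ij * log (p ij.1) + r ij * log (q ij.2) := by
    intro ij
    by_cases h : r ij = 0
    · simp [h]
    · rw [log_mul (hne _ _ h).1 (hne _ _ h).2, mul_add]
  rw [hone, log_one] at key
  simp only [hlog, Finset.sum_add_distrib] at key
  have e1 : ∑ ij : ι × κ, r ij * log (p ij.1) = - partitionEntropy μ ξ := by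
    rw [Fintype.sum_prod_type]
    simp only [← Finset.sum_mul, hsp]
    simp [partitionEntropy, negMulLog, hp]
  have e2 : ∑ ij : ι × κ, r ij * log (q ij.2) = - partitionEntropy μ ζ := by
    rw [Fintype.sum_prod_type_right]
    simp only [← Finset.sum_mul, hsq]
    simp [partitionEntropy, negMulLog, hq]
  rw [e1, e2] at key
  change ∑ ij, negMulLog (r ij) ≤ _
  linarith

/-- Entropy is convex in the measure up to an additive constant. -/
theorem partitionEntropy_le_convexCombination {μ ν₁ ν₂ : ProbabilityMeasure X} {a b : ℝ}
    (ha : 0 ≤ a) (hb : 0 ≤ b) [MeasurableSpace ι] [MeasurableSingletonClass ι]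
    {ξ : X → ι} (hξ : Measurable ξ)
    (h : ∀ s, MeasurableSet s →
      (μ : Measure X).real s = a * (ν₁ : Measure X).real s + b * (ν₂ : Measure X).real s) :
    partitionEntropy μ ξ ≤ a * partitionEntropy ν₁ ξ + b * partitionEntropy ν₂ ξ
      + (negMulLog a + negMulLog b) := by
  have key : ∀ i, negMulLog ((μ : Measure X).real (ξ ⁻¹' {i})) ≤
      ((ν₁ : Measure X).real (ξ ⁻¹' {i}) * negMulLog a
        + a * negMulLog ((ν₁ : Measure X).real (ξ ⁻¹' {i}))) +
      ((ν₂ : Measure X).real (ξ ⁻¹' {i}) * negMulLog b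
        + b * negMulLog ((ν₂ : Measure X).real (ξ ⁻¹' {i}))) := by
    intro i
    rw [h _ (hξ (measurableSet_singleton i)), ← negMulLog_mul, ← negMulLog_mul]
    have := negMulLog_sum_le Finset.univ
      ![a * (ν₁ : Measure X).real (ξ ⁻¹' {i}), b * (ν₂ : Measure X).real (ξ ⁻¹' {i})] (by
        intro j _
        fin_cases j
        · exact mul_nonneg ha measureReal_nonneg
        · exact mul_nonneg hb measureReal_nonneg)
    simpa using this
  refine (Finset.sum_le_sum fun i _ => key i).trans_eq ?_
  simp only [Finset.sum_add_distrib, ← Finset.sum_mul, ← Finset.mul_sum,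
    sum_real_preimage_singleton _ hξ, partitionEntropy]
  ring

/-- Entropy is concave in the measure. -/
theorem sum_partitionEntropy_le {α : Type*} {μ : ProbabilityMeasure X} (s : Finset α)
    (w : α → ℝ) (ν : α → ProbabilityMeasure X) (hw : ∀ a ∈ s, 0 ≤ w a) (hw1 : ∑ a ∈ s, w a = 1)
    [MeasurableSpace ι] [MeasurableSingletonClass ι] {ξ : X → ι} (hξ : Measurable ξ)
    (h : ∀ A, MeasurableSet A →
      (μ : Measure X).real A = ∑ a ∈ s, w a * (ν a : Measure X).real A) :
    ∑ a ∈ s, w a * partitionEntropy (ν a) ξ ≤ partitionEntropy μ ξ := by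
  simp only [partitionEntropy, Finset.mul_sum]
  rw [Finset.sum_comm]
  refine Finset.sum_le_sum fun i _ => ?_
  rw [h _ (hξ (measurableSet_singleton i))]
  simpa using concaveOn_negMulLog.le_map_sum hw hw1
    (p := fun a => (ν a : Measure X).real (ξ ⁻¹' {i})) (fun a _ => measureReal_nonneg)

theorem metricEntropy_nonneg (f : X → X) : 0 ≤ metricEntropy f μ := by
  refine le_iSup₂_of_le 1 (fun _ => 0) (le_iSup_of_le measurable_const ?_)
  refine le_limsup_of_frequently_le (Eventually.frequently (Eventually.of_forall fun n => ?_))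
    (by isBoundedDefault)
  exact_mod_cast div_nonneg (partitionEntropy_nonneg μ _) n.cast_nonneg

/-- The supremum runs over labels in `Fin k` only; relabelling admits any finite label type, such as
the `Fin k → Bool` used below. -/
theorem entropyOfPartition_le_metricEntropy [MeasurableSpace ι] [MeasurableSingletonClass ι]
    {f : X → X} (hf : Measurable f) {ξ : X → ι} (hξ : Measurable ξ) :
    entropyOfPartition f μ ξ ≤ metricEntropy f μ := by
  let e := Fintype.equivFin ι
  have he : Measurable (e ∘ ξ) := (measurable_of_finite _).comp hξ
  refine le_iSup₂_of_le (Fintype.card ι) (e ∘ ξ) (le_iSup_of_le he ?_)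
  refine limsup_le_limsup (Eventually.of_forall fun n => ?_)
  have := partitionEntropy_mono μ (ξ := itinerary f ξ n) (measurable_itinerary hf he n)
    (fun x y hxy => funext fun j => e.injective (congrFun hxy j))
  exact EReal.coe_le_coe_iff.2 (div_le_div_of_nonneg_right this n.cast_nonneg)

end PartitionEntropy

/-! ### Counting itineraries against separated sets -/

section UpperBound

variable {X : Type*}

/-- A separated set of maximal cardinality is spanning, since otherwise a point could be added.
Cardinalities are bounded because finitely many Bowen balls of radius `ε / 2` cover `X`, and each
holds at most one point of a separated set. -/
theorem exists_separated_spanning [MetricSpace X] [CompactSpace X] {f : X → X}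
    (hf : Continuous f) (n : ℕ) {ε : ℝ} (hε : 0 < ε) :
    ∃ F : Finset X, IsSeparated f n ε F ∧
      ∀ x, ∃ y ∈ F, ∀ j < n, dist (f^[j] x) (f^[j] y) ≤ ε := by
  classical
  let U : X → Set X := fun x => ⋂ j ∈ Finset.range n, {z | dist (f^[j] z) (f^[j] x) < ε / 2}
  have hU : ∀ x, U x ∈ 𝓝 x := by
    intro x
    refine (Filter.biInter_finset_mem _).2 fun j _ => ?_
    have hj := hf.iterate j
    exact (isOpen_lt (by fun_prop) continuous_const).mem_nhds (by simpa using half_pos hε)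
  obtain ⟨t, -, ht⟩ := isCompact_univ.elim_nhds_subcover U fun x _ => hU x
  have hcov : ∀ x, ∃ y ∈ t, x ∈ U y := fun x => by simpa using ht (Set.mem_univ x)
  choose g hgt hgU using hcov
  have hcard : ∀ F : Finset X, IsSeparated f n ε F → F.card ≤ t.card := by
    intro F hF
    refine Finset.card_le_card_of_injOn g (fun x _ => hgt x) fun x hx y hy hxy => ?_
    by_contra hne
    obtain ⟨j, hj, hd⟩ := hF x hx y hy hne
    have h1 := hgU x
    have h2 := hgU y
    rw [← hxy] at h2
    simp only [U, Set.mem_iInter, Finset.mem_range, Set.mem_ofPred_eq] at h1 h2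
    have := dist_triangle_right (f^[j] x) (f^[j] y) (f^[j] (g x))
    linarith [h1 j hj, h2 j hj]
  let S : Set ℕ := {m | ∃ F : Finset X, IsSeparated f n ε F ∧ F.card = m}
  have hS : BddAbove S := ⟨t.card, by rintro m ⟨F, hF, rfl⟩; exact hcard F hF⟩
  have hS0 : S.Nonempty := ⟨0, ∅, by simp [IsSeparated], rfl⟩
  obtain ⟨F, hF, hFc⟩ := Nat.sSup_mem hS0 hS
  refine ⟨F, hF, fun x => ?_⟩
  by_contra! hx
  have hxF : x ∉ F := fun h => by
    obtain ⟨j, -, hj⟩ := hx x h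
    simp only [dist_self] at hj
    linarith
  have hins : IsSeparated f n ε (insert x F) := by
    intro a ha b hb hab
    rw [Finset.mem_insert] at ha hb
    rcases ha with rfl | ha <;> rcases hb with rfl | hb
    · exact absurd rfl hab
    · exact hx b hb
    · obtain ⟨j, hj, h⟩ := hx a ha
      exact ⟨j, hj, by rwa [dist_comm]⟩
    · exact hF a ha b hb hab
  have := le_csSup hS ⟨_, hins, rfl⟩
  rw [Finset.card_insert_of_notMem hxF] at this
  omega

theorem integral_birkhoffSum [MeasurableSpace X] {μ : Measure X} {f : X → X}
    (hf : MeasurePreserving f μ μ) {ψ : X → ℝ} (hψ : Integrable ψ μ) (n : ℕ) :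
    Integrable (birkhoffSum f ψ n) μ ∧ ∫ x, birkhoffSum f ψ n x ∂μ = n * ∫ x, ψ x ∂μ := by
  have hint : ∀ j, Integrable (fun x => ψ (f^[j] x)) μ := fun j =>
    (hf.iterate j).integrable_comp_of_integrable hψ
  refine ⟨integrable_finsetSum _ fun j _ => hint j, ?_⟩
  simp only [birkhoffSum]
  rw [integral_finsetSum _ fun j _ => hint j]
  have : ∀ j, ∫ x, ψ (f^[j] x) ∂μ = ∫ x, ψ x ∂μ := fun j => by
    have h := hf.iterate j
    nth_rw 2 [← h.map_eq]
    rw [integral_map h.aemeasurable]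
    rw [h.map_eq]
    exact hψ.aestronglyMeasurable
  simp [this]

/-- Gibbs' inequality for a finite partition: entropy plus integral is bounded by the logarithm of
the sum of `exp Ψ` over suitable points, one in each of some of the cells. -/
theorem exists_partitionEntropy_add_integral_le [MeasurableSpace X] (μ : ProbabilityMeasure X)
    {κ : Type*} [Fintype κ] [MeasurableSpace κ] [MeasurableSingletonClass κ] {ζ : X → κ}
    (hζ : Measurable ζ) {Ψ : X → ℝ} (hΨ : Integrable Ψ (μ : Measure X)) :
    ∃ (S : Finset κ) (z : κ → X), S.Nonempty ∧ (∀ c ∈ S, ζ (z c) = c) ∧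
      partitionEntropy μ ζ + ∫ x, Ψ x ∂(μ : Measure X) ≤ log (∑ c ∈ S, exp (Ψ (z c))) := by
  classical
  have : Nonempty X := μ.nonempty
  set p : κ → ℝ := fun c => (μ : Measure X).real (ζ ⁻¹' {c}) with hp
  have hmeas : ∀ c, MeasurableSet (ζ ⁻¹' {c}) := fun c => hζ (measurableSet_singleton c)
  -- In a cell of positive mass some point has `Ψ` at least its mean over the cell. Null cells may
  -- be empty and are dropped from `S`.
  have hex : ∀ c, ∃ x, p c ≠ 0 → ζ x = c ∧ ∫ x in ζ ⁻¹' {c}, Ψ x ∂(μ : Measure X) ≤ p c * Ψ x := by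
    intro c
    by_cases hc : p c = 0
    · exact ⟨Classical.arbitrary X, fun h => absurd hc h⟩
    · have hc' : (μ : Measure X) (ζ ⁻¹' {c}) ≠ 0 := fun h => hc (by simp [hp, Measure.real, h])
      obtain ⟨x, hx, hle⟩ := exists_setAverage_le hc' (measure_ne_top _ _) hΨ.integrableOn
      refine ⟨x, fun _ => ⟨hx, ?_⟩⟩
      rw [setAverage_eq, smul_eq_mul] at hle
      have hpos : 0 < p c := measureReal_nonneg.lt_of_ne (Ne.symm hc)
      rwa [inv_mul_le_iff₀ hpos] at hle
  choose z hz using hex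
  have hne : (Finset.univ.filter fun c => p c ≠ 0).Nonempty := by
    obtain ⟨c, -, hc⟩ := Finset.exists_ne_zero_of_sum_ne_zero
      ((sum_real_preimage_singleton μ hζ).trans_ne one_ne_zero)
    exact ⟨c, Finset.mem_filter.2 ⟨Finset.mem_univ c, hc⟩⟩
  refine ⟨Finset.univ.filter fun c => p c ≠ 0, z, hne, fun c hc => (hz c (by simpa using hc)).1, ?_⟩
  have key := sum_negMulLog_add_mul_log_le p (fun c => if p c ≠ 0 then exp (Ψ (z c)) else 0)
    (fun _ => measureReal_nonneg) (sum_real_preimage_singleton μ hζ)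
    (fun c => by positivity) (fun c hc => by simp [hc, (exp_pos _).ne'])
  rw [Finset.sum_filter]
  refine le_trans ?_ key
  rw [Finset.sum_add_distrib]
  refine add_le_add le_rfl ?_
  have hun : ∫ x, Ψ x ∂(μ : Measure X) = ∑ c, ∫ x in ζ ⁻¹' {c}, Ψ x ∂(μ : Measure X) := by
    rw [← setIntegral_univ, ← integral_iUnion_fintype hmeas ?_ fun c => hΨ.integrableOn]
    · congr 2
      ext x
      simp
    · intro c d hcd
      exact Disjoint.preimage _ (by simpa using hcd)
  rw [hun]
  refine Finset.sum_le_sum fun c _ => ?_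
  by_cases hc : p c = 0
  · have hc' : (μ : Measure X) (ζ ⁻¹' {c}) = 0 := by
      simpa [hp, Measure.real, ENNReal.toReal_eq_zero_iff] using hc
    rw [Measure.restrict_eq_zero.2 hc']
    simp [hc]
  · simpa [hc] using (hz c hc).2

/-- For an itinerary of length `n` of labels `(ξ x, x ∈ B)`, the good letters of which are
determined by any point shadowing it, the weighted number of shadowed itineraries is at most
`(1 + card ι * τ) ^ n`. -/
theorem sum_exp_itinerary_le [MetricSpace X] {ι : Type*} [Fintype ι] [DecidableEq ι] {f : X → X}
    {ξ : X → ι} {B : Set X} [DecidablePred (· ∈ B)] {ε δ τ : ℝ} (hτ : 0 < τ) {φ : X → ℝ}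
    (hB : ∀ x ∈ B, ∀ y ∈ B, ξ x ≠ ξ y → 2 * ε < dist x y)
    (hφ : ∀ x y, dist x y ≤ ε → φ x ≤ φ y + δ) (n : ℕ) (S : Finset (Fin n → ι × Bool))
    (z : (Fin n → ι × Bool) → X)
    (hz : ∀ c ∈ S, itinerary f (fun x => (ξ x, decide (x ∈ B))) n (z c) = c)
    (F : Finset X) (hF : ∀ x, ∃ y ∈ F, ∀ j < n, dist (f^[j] x) (f^[j] y) ≤ ε) :
    ∑ c ∈ S, exp (birkhoffSum f (fun x => φ x + if x ∈ B then 0 else log τ) n (z c)) ≤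
      (∑ y ∈ F, exp (birkhoffSum f φ n y)) * (exp δ * (1 + Fintype.card ι * τ)) ^ n := by
  classical
  choose g hgF hg using hF
  -- A visit to `B` costs nothing, a visit to the complement costs a factor `τ`.
  let wt : ι × Bool → ℝ := fun l => if l.2 then 1 else τ
  have hwt : ∀ l, 0 ≤ wt l := fun l => by dsimp only [wt]; split_ifs <;> linarith
  -- The letters a point within `ε` of `y` may carry. By `hB` at most one is good, since two good
  -- points near `y` are at most `2 * ε` apart; every bad letter is allowed, at total weight `card ι
  -- * τ`.
  let Lt : X → Finset (ι × Bool) := fun y =>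
    Finset.univ.filter fun l => l.2 = true → ∃ x ∈ B, ξ x = l.1 ∧ dist x y ≤ ε
  have hLt : ∀ y, ∑ l ∈ Lt y, wt l ≤ 1 + Fintype.card ι * τ := by
    intro y
    rw [Finset.sum_filter, Fintype.sum_prod_type]
    simp only [Fintype.sum_bool, Finset.sum_add_distrib]
    refine add_le_add ?_ ?_
    · simp only [wt, if_true, forall_const]
      rw [Finset.sum_boole]
      have : (Finset.univ.filter fun i => ∃ x ∈ B, ξ x = i ∧ dist x y ≤ ε).card ≤ 1 := by
        refine Finset.card_le_one.2 fun i hi i' hi' => ?_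
        obtain ⟨x, hx, rfl, hxy⟩ := (Finset.mem_filter.1 hi).2
        obtain ⟨x', hx', rfl, hxy'⟩ := (Finset.mem_filter.1 hi').2
        by_contra hne
        have := hB x hx x' hx' hne
        linarith [dist_triangle_right x x' y]
      exact_mod_cast this
    · simp [wt]
  have hterm : ∀ c ∈ S,
      exp (birkhoffSum f (fun x => φ x + if x ∈ B then 0 else log τ) n (z c)) ≤
        exp (birkhoffSum f φ n (g (z c))) * exp δ ^ n * ∏ j, wt (c j) := by
    intro c hc
    simp only [birkhoffSum, exp_sum, exp_add, Finset.prod_mul_distrib]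
    have h1 : ∏ j ∈ Finset.range n, exp (if f^[j] (z c) ∈ B then 0 else log τ) = ∏ j, wt (c j) := by
      rw [Finset.prod_range]
      refine Finset.prod_congr rfl fun j _ => ?_
      rw [← congrFun (hz c hc) j]
      simp only [wt, itinerary, decide_eq_true_eq]
      split_ifs
      · exact exp_zero
      · exact exp_log hτ
    rw [h1]
    refine mul_le_mul_of_nonneg_right ?_ (Finset.prod_nonneg fun j _ => hwt _)
    have h2 : exp δ ^ n = ∏ _j ∈ Finset.range n, exp δ := by simp
    rw [h2, ← Finset.prod_mul_distrib]
    refine Finset.prod_le_prod (fun j _ => (exp_pos _).le) fun j hj => ?_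
    rw [← exp_add]
    exact exp_le_exp.2 (hφ _ _ (hg _ j (Finset.mem_range.1 hj)))
  have hmem : ∀ c ∈ S, c ∈ Fintype.piFinset fun j : Fin n => Lt (f^[j] (g (z c))) := by
    intro c hc
    refine Fintype.mem_piFinset.2 fun j => Finset.mem_filter.2 ⟨Finset.mem_univ _, fun h => ?_⟩
    have hcj := congrFun (hz c hc) j
    rw [← hcj] at h ⊢
    exact ⟨f^[j] (z c), by simpa [itinerary] using h, rfl, hg _ _ j.2⟩
  have hfib : ∀ y, ∑ c ∈ S with g (z c) = y, ∏ j, wt (c j) ≤ (1 + Fintype.card ι * τ) ^ n := by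
    intro y
    have h1 : ∑ c ∈ S with g (z c) = y, ∏ j, wt (c j) ≤
        ∑ c ∈ Fintype.piFinset fun j : Fin n => Lt (f^[j] y), ∏ j, wt (c j) := by
      refine Finset.sum_le_sum_of_subset_of_nonneg (fun c hc => ?_)
        fun c _ _ => Finset.prod_nonneg fun j _ => hwt _
      obtain ⟨hcS, rfl⟩ := Finset.mem_filter.1 hc
      exact hmem c hcS
    -- The sum over words factorises into one sum over letters for each time.
    have h2 : ∑ c ∈ Fintype.piFinset fun j : Fin n => Lt (f^[j] y), ∏ j, wt (c j) =
        ∏ j : Fin n, ∑ l ∈ Lt (f^[j] y), wt l :=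
      (Finset.prod_univ_sum (fun j : Fin n => Lt (f^[j] y)) fun _ => wt).symm
    have h3 : ∏ j : Fin n, ∑ l ∈ Lt (f^[j] y), wt l ≤ ∏ _j : Fin n, (1 + Fintype.card ι * τ) :=
      Finset.prod_le_prod (fun j _ => Finset.sum_nonneg fun l _ => hwt l) fun j _ => hLt _
    rw [Finset.prod_const, Finset.card_univ, Fintype.card_fin] at h3
    exact h1.trans (h2.trans_le h3)
  calc _ ≤ ∑ c ∈ S, exp (birkhoffSum f φ n (g (z c))) * exp δ ^ n * ∏ j, wt (c j) :=
        Finset.sum_le_sum hterm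
    _ = ∑ y ∈ F, ∑ c ∈ S with g (z c) = y,
          exp (birkhoffSum f φ n (g (z c))) * exp δ ^ n * ∏ j, wt (c j) :=
        (Finset.sum_fiberwise_of_maps_to (fun c _ => hgF (z c)) _).symm
    _ ≤ ∑ y ∈ F, exp (birkhoffSum f φ n y) * (exp δ * (1 + Fintype.card ι * τ)) ^ n := by
        refine Finset.sum_le_sum fun y _ => ?_
        have : ∀ c ∈ S.filter fun c => g (z c) = y,
            exp (birkhoffSum f φ n (g (z c))) * exp δ ^ n * ∏ j, wt (c j) =
              exp (birkhoffSum f φ n y) * exp δ ^ n * ∏ j, wt (c j) := fun c hc => by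
          rw [(Finset.mem_filter.1 hc).2]
        rw [Finset.sum_congr rfl this, ← Finset.mul_sum, mul_pow, mul_assoc]
        refine mul_le_mul_of_nonneg_left (mul_le_mul_of_nonneg_left ?_ (by positivity))
          (exp_pos _).le
        exact hfib y
    _ = _ := by rw [Finset.sum_mul]

end UpperBound

/-! ### Upper half of the variational principle -/

section UpperBound

variable {X : Type*} [MetricSpace X]

theorem log_sum_le_log_separatedSum {f : X → X} (φ : C(X, ℝ)) {n : ℕ} {ε : ℝ} {F : Finset X}
    (hF : IsSeparated f n ε F) (hne : F.Nonempty) :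
    ((log (∑ y ∈ F, exp (birkhoffSum f φ n y)) : ℝ) : EReal) ≤
      ENNReal.log (separatedSum f φ n ε) := by
  have hpos : 0 < ∑ y ∈ F, exp (birkhoffSum f φ n y) :=
    Finset.sum_pos (fun _ _ => exp_pos _) hne
  rw [← ENNReal.log_ofReal_of_pos hpos, ENNReal.ofReal_sum_of_nonneg fun _ _ => (exp_pos _).le]
  exact ENNReal.log_monotone (le_iSup₂_of_le F hF le_rfl)

variable [CompactSpace X] [MeasurableSpace X] [BorelSpace X]

/-- Each cell contains a closed set missing little of its mass, and disjoint compact sets lie at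
positive distance; `B` is the union of these sets. -/
theorem exists_measurableSet_separating (μ : Measure X) [IsFiniteMeasure μ] {ι : Type*} [Fintype ι]
    [MeasurableSpace ι] [MeasurableSingletonClass ι] {ξ : X → ι} (hξ : Measurable ξ) {κ : ℝ}
    (hκ : 0 < κ) :
    ∃ B : Set X, MeasurableSet B ∧ μ.real Bᶜ ≤ κ ∧
      ∀ᶠ ε in 𝓝[>] (0 : ℝ), ∀ x ∈ B, ∀ y ∈ B, ξ x ≠ ξ y → 2 * ε < dist x y := by
  classical
  have hκ' : 0 < κ / (Fintype.card ι + 1) := by positivity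
  have hm : ∀ i, MeasurableSet (ξ ⁻¹' {i}) := fun i => hξ (measurableSet_singleton i)
  choose K hKs hKc hK using fun i => (hm i).exists_isClosed_sdiff_lt (measure_ne_top μ _)
    (ENNReal.ofReal_pos.2 hκ').ne'
  refine ⟨⋃ i, K i, MeasurableSet.iUnion fun i => (hKc i).measurableSet, ?_, ?_⟩
  · have hsub : (⋃ i, K i)ᶜ ⊆ ⋃ i, (ξ ⁻¹' {i} \ K i) := fun x hx =>
      Set.mem_iUnion.2 ⟨ξ x, rfl, fun h => hx (Set.mem_iUnion.2 ⟨_, h⟩)⟩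
    calc μ.real (⋃ i, K i)ᶜ ≤ μ.real (⋃ i, (ξ ⁻¹' {i} \ K i)) := measureReal_mono hsub
      _ ≤ ∑ i, μ.real (ξ ⁻¹' {i} \ K i) := measureReal_iUnion_fintype_le _
      _ ≤ ∑ _i : ι, κ / (Fintype.card ι + 1) := Finset.sum_le_sum fun i _ =>
          ENNReal.toReal_le_of_le_ofReal hκ'.le (hK i).le
      _ ≤ κ := by
          rw [Finset.sum_const, Finset.card_univ, nsmul_eq_mul, ← mul_div_assoc,
            div_le_iff₀ (by positivity)]
          nlinarith
  · have hpair : ∀ i j, i ≠ j →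
        ∀ᶠ ε in 𝓝[>] (0 : ℝ), ∀ x ∈ K i, ∀ y ∈ K j, 2 * ε < dist x y := by
      intro i j hij
      have hd : Disjoint (K i) (K j) :=
        (Disjoint.preimage ξ (by simpa using hij)).mono (hKs i) (hKs j)
      obtain ⟨r, hr, h⟩ := Metric.exists_pos_forall_lt_edist (hKc i).isCompact (hKc j) hd
      have : ∀ᶠ ε : ℝ in 𝓝[>] 0, ε < (r : ℝ) / 2 :=
        nhdsWithin_le_nhds (eventually_lt_nhds (by positivity))
      filter_upwards [this] with ε hε x hx y hy
      have h1 := h x hx y hy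
      rw [edist_nndist, ENNReal.coe_lt_coe, ← NNReal.coe_lt_coe, coe_nndist] at h1
      linarith
    have hall : ∀ᶠ ε in 𝓝[>] (0 : ℝ), ∀ i j, i ≠ j → ∀ x ∈ K i, ∀ y ∈ K j, 2 * ε < dist x y := by
      refine eventually_all.2 fun i => eventually_all.2 fun j => ?_
      by_cases hij : i = j
      · exact Eventually.of_forall fun _ h => absurd hij h
      · exact (hpair i j hij).mono fun _ h _ => h
    filter_upwards [hall] with ε hε x hx y hy hxy
    obtain ⟨i, hi⟩ := Set.mem_iUnion.1 hx
    obtain ⟨j, hj⟩ := Set.mem_iUnion.1 hy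
    refine hε i j (fun hij => hxy ?_) x hi y hj
    rw [show ξ x = i from hKs i hi, show ξ y = j from hKs j hj, hij]

/-- Adding `log τ` to `φ` off `B` makes itineraries countable by a separated set without the usual
loss of a factor per step, so no passage to powers of `f` is needed. Each `η` pays for one error:
the integral of the penalty, the oscillation of `φ` at scale `ε`, and `log (1 + card ι * τ)`. -/
theorem entropyOfPartition_le_of_topPressure_lt {f : X → X} (hf : Continuous f)
    {μ : ProbabilityMeasure X} (hμ : μ ∈ invariantMeasures f) {ι : Type*} [Fintype ι]
    [MeasurableSpace ι] [MeasurableSingletonClass ι] {ξ : X → ι} (hξ : Measurable ξ)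
    (φ : C(X, ℝ)) {c η : ℝ} (hc : topPressure f φ < c) (hη : 0 < η) :
    entropyOfPartition f μ ξ ≤ ((c + 3 * η - ∫ x, φ x ∂(μ : Measure X) : ℝ) : EReal) := by
  classical
  have hX : Nonempty X := μ.nonempty
  set τ : ℝ := min 1 (η / (Fintype.card ι + 1)) with hτdef
  have hτ : 0 < τ := lt_min one_pos (by positivity)
  have hτ1 : τ ≤ 1 := min_le_left _ _
  have hτη : Fintype.card ι * τ ≤ η := by
    have : τ * (Fintype.card ι + 1) ≤ η := by
      rw [← le_div_iff₀ (by positivity)]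
      exact min_le_right _ _
    nlinarith
  have hlogτ : log τ ≤ 0 := log_nonpos hτ.le hτ1
  -- The mass of `Bᶜ` is chosen after `τ`, so that the penalty integrates to at least `-η`; the `1`
  -- keeps the denominator positive when `τ = 1`.
  obtain ⟨B, hBm, hBμ, hBε⟩ := exists_measurableSet_separating (μ : Measure X) hξ
    (κ := η / (1 - log τ)) (div_pos hη (by linarith))
  have huc : ∀ᶠ ε in 𝓝[>] (0 : ℝ), ∀ x y, dist x y ≤ ε → φ x ≤ φ y + η := by
    obtain ⟨δ, hδ, h⟩ := Metric.uniformContinuous_iff.1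
      (CompactSpace.uniformContinuous_of_continuous φ.continuous) η hη
    filter_upwards [nhdsWithin_le_nhds (eventually_lt_nhds hδ)] with ε hε x y hxy
    have := (abs_lt.1 (h (hxy.trans_lt hε))).2
    linarith
  obtain ⟨ε, hBε, hφε, hε0⟩ :=
    (hBε.and (huc.and (eventually_mem_nhdsWithin (a := (0 : ℝ)) (s := Set.Ioi 0)))).exists
  have hε0 : 0 < ε := hε0
  set ψ : X → ℝ := fun x => φ x + if x ∈ B then 0 else log τ with hψ
  have hφint : Integrable (fun x => φ x) (μ : Measure X) :=
    φ.continuous.integrable_of_hasCompactSupport (HasCompactSupport.of_compactSpace _)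
  have hψ' : ψ = fun x => φ x + Bᶜ.indicator (fun _ => log τ) x := by
    ext x
    by_cases hx : x ∈ B <;> simp [hψ, hx]
  have hindint : Integrable (Bᶜ.indicator fun _ => log τ) (μ : Measure X) :=
    (integrable_const _).indicator hBm.compl
  have hψint : Integrable ψ (μ : Measure X) := hψ' ▸ hφint.add hindint
  have hψval : ∫ x, φ x ∂(μ : Measure X) - η ≤ ∫ x, ψ x ∂(μ : Measure X) := by
    rw [hψ', integral_add hφint hindint, integral_indicator_const _ hBm.compl, smul_eq_mul]
    have h1 : (μ : Measure X).real Bᶜ * (1 - log τ) ≤ η := by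
      rwa [le_div_iff₀ (by linarith)] at hBμ
    have h2 : 0 ≤ (μ : Measure X).real Bᶜ := measureReal_nonneg
    nlinarith
  have hfm := hf.measurable
  have hlab : Measurable fun x => (ξ x, decide (x ∈ B)) :=
    hξ.prodMk (measurable_to_bool (by
      convert hBm using 1
      ext x
      simp))
  have key : ∀ n : ℕ, ∃ F : Finset X, F.Nonempty ∧ IsSeparated f n ε F ∧
      partitionEntropy μ (itinerary f ξ n) + n * (∫ x, φ x ∂(μ : Measure X) - η) ≤
        log (∑ y ∈ F, exp (birkhoffSum f φ n y)) + n * (2 * η) := by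
    intro n
    obtain ⟨F, hF, hFs⟩ := exists_separated_spanning hf n hε0
    have hFne : F.Nonempty := by
      obtain ⟨y, hy, -⟩ := hFs hX.some
      exact ⟨y, hy⟩
    refine ⟨F, hFne, hF, ?_⟩
    obtain ⟨hint, hval⟩ := integral_birkhoffSum hμ hψint n
    have hitm := measurable_itinerary hfm hlab n
    obtain ⟨S, z, hSne, hz, hle⟩ := exists_partitionEntropy_add_integral_le μ hitm hint
    rw [hval] at hle
    have hcount := sum_exp_itinerary_le hτ hBε hφε n S z hz F hFs
    have hmono := partitionEntropy_mono μ (ξ := itinerary f ξ n) hitm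
      (fun x y hxy => funext fun j => congrArg Prod.fst (congrFun hxy j))
    have hZ : 0 < ∑ y ∈ F, exp (birkhoffSum f φ n y) := Finset.sum_pos (fun _ _ => exp_pos _) hFne
    have hfac : 0 < 1 + Fintype.card ι * τ := by positivity
    have hlog : log (∑ c ∈ S, exp (birkhoffSum f ψ n (z c))) ≤
        log (∑ y ∈ F, exp (birkhoffSum f φ n y)) + n * (2 * η) := by
      have hS : 0 < ∑ c ∈ S, exp (birkhoffSum f ψ n (z c)) :=
        Finset.sum_pos (fun _ _ => exp_pos _) hSne
      refine (log_le_log hS hcount).trans ?_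
      rw [log_mul hZ.ne' (by positivity), log_pow, log_mul (exp_pos _).ne' hfac.ne', log_exp]
      have : log (1 + Fintype.card ι * τ) ≤ η := by
        linarith [log_le_sub_one_of_pos hfac]
      have hn : (0 : ℝ) ≤ n := n.cast_nonneg
      nlinarith
    have hn : (0 : ℝ) ≤ n := n.cast_nonneg
    have := mul_le_mul_of_nonneg_left hψval hn
    linarith
  have hlt : limsup (fun n : ℕ => ENNReal.log (separatedSum f φ n ε) / (n : EReal)) atTop < c :=
    (le_iSup₂_of_le (f := fun (ε : ℝ) (_ : 0 < ε) =>
      limsup (fun n : ℕ => ENNReal.log (separatedSum f φ n ε) / (n : EReal)) atTop)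
      ε hε0 le_rfl).trans_lt hc
  refine limsup_le_of_le (by isBoundedDefault) ?_
  filter_upwards [eventually_lt_of_limsup_lt hlt, eventually_gt_atTop 0] with n hn hn0
  obtain ⟨F, hFne, hF, hle⟩ := key n
  have hn0' : (0 : ℝ) < n := by exact_mod_cast hn0
  have h1 := (EReal.div_le_div_right_of_nonneg (c := (n : EReal)) (by positivity)
    (log_sum_le_log_separatedSum φ hF hFne)).trans_lt hn
  rw [← EReal.coe_coe_eq_natCast, ← EReal.coe_div, EReal.coe_lt_coe_iff, div_lt_iff₀ hn0'] at h1
  rw [EReal.coe_le_coe_iff, div_le_iff₀ hn0']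
  nlinarith

/-- The upper half of the variational principle. -/
theorem measurePressure_le_topPressure {f : X → X} (hf : Continuous f)
    {μ : ProbabilityMeasure X} (hμ : μ ∈ invariantMeasures f) (φ : C(X, ℝ)) :
    measurePressure f φ μ ≤ topPressure f φ := by
  refine EReal.le_of_forall_lt_iff_le.1 fun c hc => ?_
  have h : metricEntropy f μ ≤ ((c - ∫ x, φ x ∂(μ : Measure X) : ℝ) : EReal) := by
    refine iSup₂_le fun k ξ => iSup_le fun hξ => ?_
    refine EReal.le_of_forall_lt_iff_le.1 fun r hr => ?_
    rw [EReal.coe_lt_coe_iff] at hr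
    refine (entropyOfPartition_le_of_topPressure_lt hf hμ hξ φ hc
      (η := (r - (c - ∫ x, φ x ∂(μ : Measure X))) / 3) (by linarith)).trans ?_
    rw [EReal.coe_le_coe_iff]
    linarith
  calc measurePressure f φ μ ≤ ((c - ∫ x, φ x ∂(μ : Measure X) : ℝ) : EReal) +
        ((∫ x, φ x ∂(μ : Measure X) : ℝ) : EReal) := add_le_add h le_rfl
    _ = c := by rw [← EReal.coe_add, sub_add_cancel]

end UpperBound

/-! ### Almost invariant measures from separated sets -/

section LowerBound

/-- Let `a s` be the entropy of the itinerary from time `s` to time `n`. Splitting off a block of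
length `q` gives `a s ≤ g s + a (s + q)`, and summing over `s < n` telescopes to a bound for the
first `q` of the `a s`. Each of these is within `q * log (card ι)` of `a 0`. -/
theorem mul_partitionEntropy_itinerary_le {X : Type*} [MeasurableSpace X]
    (σ : ProbabilityMeasure X) {f : X → X} (hf : Measurable f) {ι : Type*} [Fintype ι]
    [MeasurableSpace ι] [MeasurableSingletonClass ι] {ξ : X → ι} (hξ : Measurable ξ) (n q : ℕ) :
    q * partitionEntropy σ (itinerary f ξ n) ≤
      ∑ s ∈ Finset.range n, partitionEntropy σ (fun x => itinerary f ξ q (f^[s] x)) +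
        q * (q * log (Fintype.card ι)) := by
  classical
  have : Nonempty ι := σ.nonempty.map ξ
  have hm : ∀ m s, Measurable fun x => itinerary f ξ m (f^[s] x) := fun m s =>
    (measurable_itinerary hf hξ m).comp (hf.iterate s)
  have hcard : (0 : ℝ) ≤ log (Fintype.card ι) := log_natCast_nonneg _
  -- Truncated subtraction makes the itinerary empty, and `a s` zero, for `s ≥ n`.
  let a : ℕ → ℝ := fun s => partitionEntropy σ fun x => itinerary f ξ (n - s) (f^[s] x)
  let g : ℕ → ℝ := fun s => partitionEntropy σ fun x => itinerary f ξ q (f^[s] x)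
  have hbound : ∀ m s, partitionEntropy σ (fun x => itinerary f ξ m (f^[s] x)) ≤
      m * log (Fintype.card ι) := by
    intro m s
    refine (partitionEntropy_le_log_card σ (hm m s)).trans_eq ?_
    simp
  have ha0 : ∀ s, n ≤ s → a s = 0 := by
    intro s hs
    refine le_antisymm ((hbound _ s).trans_eq ?_) (partitionEntropy_nonneg σ _)
    simp [Nat.sub_eq_zero_of_le hs]
  have hsplit : ∀ s m, a s ≤ partitionEntropy σ (fun x => itinerary f ξ m (f^[s] x)) +
      a (s + m) := by
    intro s m
    refine le_trans ?_ (partitionEntropy_prodMk_le σ (hm m s) (hm (n - (s + m)) (s + m)))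
    refine partitionEntropy_mono σ ((hm m s).prodMk (hm _ _)) fun x y hxy => funext fun j => ?_
    obtain ⟨h1, h2⟩ := Prod.mk.inj hxy
    by_cases hj : (j : ℕ) < m
    · exact congrFun h1 ⟨j, hj⟩
    · have := congrFun h2 ⟨j - m, by omega⟩
      simp only [itinerary, ← Function.iterate_add_apply] at this ⊢
      rwa [show (j : ℕ) - m + (s + m) = j + s by omega] at this
  have htel : ∑ s ∈ Finset.range q, a s ≤ ∑ s ∈ Finset.range n, g s := by
    have h1 : ∑ s ∈ Finset.range n, a s ≤
        ∑ s ∈ Finset.range n, g s + ∑ s ∈ Finset.range n, a (s + q) := by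
      rw [← Finset.sum_add_distrib]
      exact Finset.sum_le_sum fun s _ => hsplit s q
    have h2 := Finset.sum_range_add a n q
    have h3 := Finset.sum_range_add a q n
    have h4 : ∑ s ∈ Finset.range q, a (n + s) = 0 :=
      Finset.sum_eq_zero fun s _ => ha0 _ (Nat.le_add_right _ _)
    have h5 : ∑ s ∈ Finset.range n, a (s + q) = ∑ s ∈ Finset.range n, a (q + s) :=
      Finset.sum_congr rfl fun s _ => by rw [add_comm]
    rw [add_comm q n] at h3
    linarith
  have hlow : ∀ s ∈ Finset.range q, a 0 - q * log (Fintype.card ι) ≤ a s := by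
    intro s hs
    have h1 := hsplit 0 s
    have h2 := hbound s 0
    rw [zero_add] at h1
    have h3 : (s : ℝ) * log (Fintype.card ι) ≤ q * log (Fintype.card ι) :=
      mul_le_mul_of_nonneg_right (by exact_mod_cast (Finset.mem_range.1 hs).le) hcard
    linarith
  have hsum := (Finset.card_nsmul_le_sum _ _ _ hlow).trans htel
  rw [Finset.card_range, nsmul_eq_mul] at hsum
  have ha : a 0 = partitionEntropy σ (itinerary f ξ n) := rfl
  rw [ha] at hsum
  linarith

theorem exists_convexCombination {X : Type*} [MeasurableSpace X] {α : Type*} (s : Finset α)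
    (w : α → ℝ) (ν : α → ProbabilityMeasure X) (hw : ∀ a ∈ s, 0 ≤ w a)
    (hw1 : ∑ a ∈ s, w a = 1) :
    ∃ μ : ProbabilityMeasure X,
      (∀ A, (μ : Measure X).real A = ∑ a ∈ s, w a * (ν a : Measure X).real A) ∧
      ∀ φ : X → ℝ, (∀ a ∈ s, Integrable φ (ν a : Measure X)) →
        ∫ x, φ x ∂(μ : Measure X) = ∑ a ∈ s, w a * ∫ x, φ x ∂(ν a : Measure X) := by
  let m : Measure X := ∑ a ∈ s, ENNReal.ofReal (w a) • (ν a : Measure X)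
  have hm : IsProbabilityMeasure m := ⟨by
    simp only [m, Measure.coe_finsetSum, Finset.sum_apply, Measure.smul_apply, measure_univ,
      smul_eq_mul, mul_one]
    rw [← ENNReal.ofReal_sum_of_nonneg hw, hw1, ENNReal.ofReal_one]⟩
  refine ⟨⟨m, hm⟩, fun A => ?_, fun φ hφ => ?_⟩
  · simp only [ProbabilityMeasure.coe_mk, Measure.real, m, Measure.coe_finsetSum, Finset.sum_apply,
      Measure.smul_apply, smul_eq_mul]
    rw [ENNReal.toReal_sum fun a _ => ENNReal.mul_ne_top ENNReal.ofReal_ne_top (measure_ne_top _ _)]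
    refine Finset.sum_congr rfl fun a ha => ?_
    rw [ENNReal.toReal_mul, ENNReal.toReal_ofReal (hw a ha)]
  · simp only [ProbabilityMeasure.coe_mk, m]
    rw [integral_finsetSum_measure fun a ha => (hφ a ha).smul_measure ENNReal.ofReal_ne_top]
    refine Finset.sum_congr rfl fun a ha => ?_
    rw [integral_smul_measure, ENNReal.toReal_ofReal (hw a ha), smul_eq_mul]

variable {X : Type*} [MetricSpace X] [MeasurableSpace X] [BorelSpace X]

/-- The weights `exp (Ψ y) / Z` on `F` give equality in Gibbs' inequality, and a partition with
cells of diameter at most `ε` separates the points of `F`. The measure comes before the partition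
because the partition will later be adapted to a limit of such measures. -/
theorem exists_log_sum_exp_le {f : X → X} (hf : Continuous f) (Ψ : X → ℝ) (n : ℕ) (ε : ℝ) {F : Finset X} (hF : IsSeparated f n ε F) (hne : F.Nonempty) :
    ∃ σ : ProbabilityMeasure X, ∀ {ι : Type} [Fintype ι] [MeasurableSpace ι]
      [MeasurableSingletonClass ι] (ξ : X → ι), Measurable ξ →
      (∀ x y, ξ x = ξ y → dist x y ≤ ε) →
      log (∑ y ∈ F, exp (Ψ y)) ≤
        partitionEntropy σ (itinerary f ξ n) + ∫ x, Ψ x ∂(σ : Measure X) := by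
  classical
  set Z := ∑ y ∈ F, exp (Ψ y) with hZ
  have hZ0 : 0 < Z := Finset.sum_pos (fun _ _ => exp_pos _) hne
  let w : X → ℝ := fun y => exp (Ψ y) / Z
  have hw : ∀ y, 0 < w y := fun y => div_pos (exp_pos _) hZ0
  have hw1 : ∑ y ∈ F, w y = 1 := by rw [← Finset.sum_div, div_self hZ0.ne']
  obtain ⟨σ, hσ, hσint⟩ := exists_convexCombination F w
    (fun y => ⟨Measure.dirac y, Measure.dirac.isProbabilityMeasure⟩) (fun y _ => (hw y).le) hw1
  refine ⟨σ, fun {ι} _ _ _ ξ hξ hdiam => ?_⟩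
  have hm := measurable_itinerary hf.measurable hξ n
  have hinj : Set.InjOn (itinerary f ξ n) F := by
    intro x hx y hy hxy
    by_contra h
    obtain ⟨j, hj, hd⟩ := hF x hx y hy h
    exact absurd (hdiam _ _ (congrFun hxy ⟨j, hj⟩)) (not_le.2 hd)
  have hint : ∫ x, Ψ x ∂(σ : Measure X) = ∑ y ∈ F, w y * Ψ y := by
    rw [hσint Ψ fun y _ => integrable_dirac (by simp)]
    simp
  have hcell : ∀ y ∈ F, (σ : Measure X).real (itinerary f ξ n ⁻¹' {itinerary f ξ n y}) = w y := by
    intro y hy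
    rw [hσ, Finset.sum_eq_single_of_mem y hy]
    · simp [Measure.real]
    · intro z hz hzy
      have : z ∉ itinerary f ξ n ⁻¹' {itinerary f ξ n y} := fun h => hzy (hinj hz hy h)
      simp [Measure.real, Measure.dirac_apply' _ (hm (measurableSet_singleton _)), this]
  have hH : ∑ y ∈ F, negMulLog (w y) ≤ partitionEntropy σ (itinerary f ξ n) := by
    calc ∑ y ∈ F, negMulLog (w y)
        = ∑ c ∈ F.image (itinerary f ξ n),
            negMulLog ((σ : Measure X).real (itinerary f ξ n ⁻¹' {c})) := by
          rw [Finset.sum_image hinj]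
          exact Finset.sum_congr rfl fun y hy => by rw [hcell y hy]
      _ ≤ _ := Finset.sum_le_sum_of_subset_of_nonneg (Finset.subset_univ _)
          fun c _ _ => negMulLog_nonneg measureReal_nonneg measureReal_le_one
  have hval : ∑ y ∈ F, negMulLog (w y) = log Z - ∑ y ∈ F, w y * Ψ y := by
    have : ∀ y, negMulLog (w y) = w y * log Z - w y * Ψ y := fun y => by
      simp only [negMulLog, w]
      rw [log_div (exp_pos _).ne' hZ0.ne', log_exp]
      ring
    simp only [this, Finset.sum_sub_distrib, ← Finset.sum_mul, hw1, one_mul]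
  rw [hint]
  linarith

variable [CompactSpace X]

theorem integrable_continuousMap (φ : C(X, ℝ)) (μ : ProbabilityMeasure X) :
    Integrable (fun x => φ x) (μ : Measure X) :=
  φ.continuous.integrable_of_hasCompactSupport (HasCompactSupport.of_compactSpace _)

/-- An almost invariant measure whose entropies and integrals dominate the sum over a separated
set. -/
theorem exists_almostInvariant {f : X → X} (hf : Continuous f) (φ : C(X, ℝ)) {n : ℕ} (hn : 0 < n)
    {ε : ℝ} {F : Finset X} (hF : IsSeparated f n ε F) (hne : F.Nonempty) :
    ∃ μ : ProbabilityMeasure X,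
      (∀ g : C(X, ℝ), |∫ x, g (f x) ∂(μ : Measure X) - ∫ x, g x ∂(μ : Measure X)| ≤
        2 * ‖g‖ / n) ∧
      ∀ {ι : Type} [Fintype ι] [MeasurableSpace ι] [MeasurableSingletonClass ι] (ξ : X → ι),
        Measurable ξ → (∀ x y, ξ x = ξ y → dist x y ≤ ε) → ∀ q : ℕ,
        q * (log (∑ y ∈ F, exp (birkhoffSum f φ n y)) / n) ≤
          partitionEntropy μ (itinerary f ξ q) + q * ∫ x, φ x ∂(μ : Measure X) +
            q * (q * log (Fintype.card ι)) / n := by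
  have hn' : (0 : ℝ) < n := by exact_mod_cast hn
  obtain ⟨σ, hσ⟩ := exists_log_sum_exp_le hf (birkhoffSum f φ n) n ε hF hne
  -- The average of the first `n` push-forwards of `σ`: integrals of `g ∘ f` and `g` then differ by
  -- a telescoping sum, and concavity of entropy bounds the averaged block entropies by that of `μ`.
  obtain ⟨μ, hμ, hμint⟩ := exists_convexCombination (Finset.range n) (fun _ => (n : ℝ)⁻¹)
    (fun j => σ.map (f := f^[j]) (hf.iterate j).measurable.aemeasurable)
    (fun _ _ => by positivity) (by simp [hn'.ne'])
  have hint : ∀ g : C(X, ℝ), ∫ x, g x ∂(μ : Measure X) =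
      ∑ j ∈ Finset.range n, (n : ℝ)⁻¹ * ∫ x, g (f^[j] x) ∂(σ : Measure X) := by
    intro g
    rw [hμint _ fun j _ => integrable_continuousMap g _]
    refine Finset.sum_congr rfl fun j _ => ?_
    congr 1
    exact integral_map (hf.iterate j).measurable.aemeasurable
      g.continuous.aestronglyMeasurable
  refine ⟨μ, fun g => ?_, fun {ι} _ _ _ ξ hξ hd q => ?_⟩
  · have h1 := hint (g.comp ⟨f, hf⟩)
    simp only [ContinuousMap.comp_apply, ContinuousMap.coe_mk] at h1
    rw [h1, hint g, ← Finset.mul_sum, ← Finset.mul_sum, ← mul_sub, ← Finset.sum_sub_distrib]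
    have h3 : ∑ j ∈ Finset.range n, (∫ x, g (f (f^[j] x)) ∂(σ : Measure X) -
        ∫ x, g (f^[j] x) ∂(σ : Measure X)) =
        ∫ x, g (f^[n] x) ∂(σ : Measure X) - ∫ x, g x ∂(σ : Measure X) := by
      have := Finset.sum_range_sub (fun j => ∫ x, g (f^[j] x) ∂(σ : Measure X)) n
      simpa only [Function.iterate_succ_apply', Function.iterate_zero, id] using this
    have hb : ∀ j, |∫ x, g (f^[j] x) ∂(σ : Measure X)| ≤ ‖g‖ := by
      intro j
      have := norm_integral_le_of_norm_le_const (μ := (σ : Measure X))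
        (f := fun x => g (f^[j] x)) (C := ‖g‖) (Eventually.of_forall fun x => g.norm_coe_le_norm _)
      simpa using this
    rw [h3, abs_mul, abs_of_pos (inv_pos.2 hn'), div_eq_inv_mul]
    refine mul_le_mul_of_nonneg_left ?_ (inv_pos.2 hn').le
    have h5 := hb 0
    simp only [Function.iterate_zero, id] at h5
    rw [abs_le] at h5 ⊢
    have h6 := abs_le.1 (hb n)
    constructor <;> linarith [h5.1, h5.2, h6.1, h6.2]
  · have hm := measurable_itinerary hf.measurable hξ q
    have h1 := hσ ξ hξ hd
    have h2 := mul_partitionEntropy_itinerary_le σ hf.measurable hξ n q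
    have h3 := sum_partitionEntropy_le (μ := μ) (Finset.range n) (fun _ => (n : ℝ)⁻¹) _
      (fun _ _ => by positivity) (by simp [hn'.ne']) hm fun A _ => hμ A
    have h4 : ∀ j, partitionEntropy (σ.map (f := f^[j]) (hf.iterate j).measurable.aemeasurable)
        (itinerary f ξ q) = partitionEntropy σ (fun x => itinerary f ξ q (f^[j] x)) := by
      intro j
      refine Finset.sum_congr rfl fun c _ => ?_
      congr 1
      exact map_measureReal_apply (hf.iterate j).measurable (hm (measurableSet_singleton c))
    simp only [h4, ← Finset.mul_sum] at h3
    have h5 : ∫ x, birkhoffSum f φ n x ∂(σ : Measure X) = n * ∫ x, φ x ∂(μ : Measure X) := by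
      rw [hint φ, ← Finset.mul_sum, ← mul_assoc, mul_inv_cancel₀ hn'.ne', one_mul]
      simp only [birkhoffSum]
      exact integral_finsetSum _ fun j _ =>
        integrable_continuousMap (φ.comp ⟨f^[j], hf.iterate j⟩) σ
    rw [h5] at h1
    rw [inv_mul_le_iff₀ hn'] at h3
    rw [mul_div_assoc', div_le_iff₀ hn', add_mul, div_mul_cancel₀ _ hn'.ne']
    have hq : (0 : ℝ) ≤ q := q.cast_nonneg
    nlinarith [mul_le_mul_of_nonneg_left h1 hq]

end LowerBound

/-! ### Weak-* limits and the lower half of the variational principle -/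

section LowerBound

variable {X : Type*} [MetricSpace X]

theorem exists_le_log_sum_exp {f : X → X} {φ : C(X, ℝ)} {n : ℕ} (hn : 0 < n) {ε r : ℝ}
    (h : (r : EReal) < ENNReal.log (separatedSum f φ n ε) / (n : EReal)) :
    ∃ F : Finset X, IsSeparated f n ε F ∧ F.Nonempty ∧
      r ≤ log (∑ y ∈ F, exp (birkhoffSum f φ n y)) / n := by
  have hn' : (0 : ℝ) < n := by exact_mod_cast hn
  rw [EReal.lt_div_iff (by exact_mod_cast hn) (EReal.natCast_ne_top n), ← EReal.coe_coe_eq_natCast,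
    ← EReal.coe_mul] at h
  have h1 : ENNReal.ofReal (exp (r * n)) < separatedSum f φ n ε := by
    rw [← ENNReal.log_lt_log_iff, ENNReal.log_ofReal_of_pos (exp_pos _), log_exp]
    exact h
  obtain ⟨F, hF⟩ := lt_iSup_iff.1 h1
  obtain ⟨hFs, hF⟩ := lt_iSup_iff.1 hF
  rw [← ENNReal.ofReal_sum_of_nonneg fun _ _ => (exp_pos _).le] at hF
  have hF' := (ENNReal.ofReal_lt_ofReal_iff_of_nonneg (exp_pos _).le).1 hF
  refine ⟨F, hFs, Finset.nonempty_iff_ne_empty.2 ?_, ?_⟩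
  · rintro rfl
    simp only [Finset.sum_empty] at hF'
    exact absurd hF' (exp_pos _).not_gt
  · rw [le_div_iff₀ hn', le_log_iff_exp_le ((exp_pos _).trans hF')]
    exact hF'.le

variable [MeasurableSpace X] [BorelSpace X]

theorem null_frontier_preimage {μ : Measure X} {f : X → X} (hf : Continuous f)
    (hμ : MeasurePreserving f μ μ) {A : Set X} (hA : μ (frontier A) = 0) :
    μ (frontier (f ⁻¹' A)) = 0 := by
  refine measure_mono_null (hf.frontier_preimage_subset A) ?_
  rw [hμ.measure_preimage isClosed_frontier.measurableSet.nullMeasurableSet, hA]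

theorem null_frontier_iInter {Y : Type*} [TopologicalSpace Y] [MeasurableSpace Y] {μ : Measure Y}
    {ι : Type*} [Fintype ι] {A : ι → Set Y}
    (hA : ∀ i, μ (frontier (A i)) = 0) : μ (frontier (⋂ i, A i)) = 0 := by
  classical
  have : ∀ s : Finset ι, μ (frontier (⋂ i ∈ s, A i)) = 0 := by
    intro s
    induction s using Finset.induction_on with
    | empty => simp
    | insert i s _ ih =>
      rw [Finset.set_biInter_insert]
      exact null_frontier_inter (hA i) ih
  simpa using this Finset.univ

theorem tendsto_partitionEntropy {α : Type*} {L : Filter α} {μs : α → ProbabilityMeasure X}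
    {μ : ProbabilityMeasure X} (h : Tendsto μs L (𝓝 μ)) {ι : Type*} [Fintype ι] {ξ : X → ι}
    (hξ : ∀ i, (μ : Measure X) (frontier (ξ ⁻¹' {i})) = 0) :
    Tendsto (fun a => partitionEntropy (μs a) ξ) L (𝓝 (partitionEntropy μ ξ)) := by
  refine tendsto_finsetSum _ fun i _ => (continuous_negMulLog.tendsto _).comp ?_
  exact (ENNReal.tendsto_toReal (measure_ne_top _ _)).comp
    (ProbabilityMeasure.tendsto_measure_of_null_frontier_of_tendsto' h (hξ i))

theorem mem_invariantMeasures_of_integral {f : X → X} (hf : Continuous f)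
    {μ : ProbabilityMeasure X}
    (h : ∀ g : C(X, ℝ), ∫ x, g (f x) ∂(μ : Measure X) = ∫ x, g x ∂(μ : Measure X)) :
    μ ∈ invariantMeasures f := by
  refine ⟨hf.measurable, ?_⟩
  have : IsProbabilityMeasure (Measure.map f (μ : Measure X)) :=
    Measure.isProbabilityMeasure_map hf.measurable.aemeasurable
  refine ext_of_forall_integral_eq_of_IsFiniteMeasure fun g => ?_
  rw [integral_map hf.measurable.aemeasurable g.continuous.aestronglyMeasurable]
  exact h g.toContinuousMap

variable [CompactSpace X]

/-- A finite partition into small sets whose boundaries are null sets. -/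
theorem exists_partition_null_frontier (μ : Measure X) [IsFiniteMeasure μ] {ε : ℝ} (hε : 0 < ε) :
    ∃ (k : ℕ) (ξ : X → (Fin k → Bool)), Measurable ξ ∧ (∀ x y, ξ x = ξ y → dist x y ≤ ε) ∧
      ∀ i, μ (frontier (ξ ⁻¹' {i})) = 0 := by
  classical
  -- Balls of radius below `ε / 2` with null boundary; a label records membership in each ball of a
  -- finite subcover, so points with equal labels share a ball.
  choose r hr hr0 using fun x : X =>
    exists_null_frontier_thickening μ {x} (a := 0) (b := ε / 2) (by linarith)
  obtain ⟨t, -, ht⟩ := isCompact_univ.elim_nhds_subcover (fun x => Metric.ball x (r x))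
    fun x _ => Metric.ball_mem_nhds x (hr x).1
  let e := t.equivFin
  let b : Fin t.card → Set X := fun i => Metric.ball (e.symm i : X) (r (e.symm i))
  have hb0 : ∀ i, μ (frontier (b i)) = 0 := fun i => by
    simpa [b, Metric.thickening_singleton] using hr0 (e.symm i : X)
  have hpre : ∀ (i : Fin t.card) (c : Bool), {x | decide (x ∈ b i) = c} =
      if c then b i else (b i)ᶜ := by
    intro i c
    ext x
    cases c <;> simp
  refine ⟨t.card, fun x i => decide (x ∈ b i), ?_, ?_, ?_⟩
  · refine measurable_pi_lambda _ fun i => measurable_to_bool ?_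
    convert (Metric.isOpen_ball.measurableSet : MeasurableSet (b i)) using 1
    ext x
    simp [b]
  · intro x y hxy
    obtain ⟨z, hz, hxz⟩ := Set.mem_iUnion₂.1 (ht (Set.mem_univ x))
    have hx : x ∈ b (e ⟨z, hz⟩) := by simpa [b] using hxz
    have hy : y ∈ b (e ⟨z, hz⟩) := by
      have := congrFun hxy (e ⟨z, hz⟩)
      simpa [hx] using this
    simp only [b, Equiv.symm_apply_apply, Metric.mem_ball] at hx hy
    have := (hr z).2
    linarith [dist_triangle_right x y z]
  · intro c
    have : (fun x i => decide (x ∈ b i)) ⁻¹' {c} = ⋂ i, if c i then b i else (b i)ᶜ := by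
      ext x
      simp only [Set.mem_preimage, Set.mem_singleton_iff, funext_iff, Set.mem_iInter, ← hpre]
      rfl
    rw [this]
    refine null_frontier_iInter fun i => ?_
    split_ifs
    · exact hb0 i
    · rw [frontier_compl]
      exact hb0 i

/-- The lower half of the variational principle. -/
theorem exists_le_measurePressure {f : X → X} (hf : Continuous f) {φ : C(X, ℝ)} {r : ℝ}
    (hr : (r : EReal) < topPressure f φ) :
    ∃ μ ∈ invariantMeasures f, (r : EReal) ≤ measurePressure f φ μ := by
  obtain ⟨ε, hr⟩ := lt_iSup_iff.1 hr
  obtain ⟨hε, hr⟩ := lt_iSup_iff.1 hr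
  let N : Set ℕ := {n | 0 < n ∧ (r : EReal) < ENNReal.log (separatedSum f φ n ε) / (n : EReal)}
  have hN : ∃ᶠ n in atTop, n ∈ N :=
    ((frequently_lt_of_lt_limsup (by isBoundedDefault) hr).and_eventually
      (eventually_gt_atTop 0)).mono fun n hn => ⟨hn.2, hn.1⟩
  have hex : ∀ n ∈ N, ∃ μ : ProbabilityMeasure X,
      (∀ g : C(X, ℝ), |∫ x, g (f x) ∂(μ : Measure X) - ∫ x, g x ∂(μ : Measure X)| ≤
        2 * ‖g‖ / n) ∧
      ∀ {ι : Type} [Fintype ι] [MeasurableSpace ι] [MeasurableSingletonClass ι] (ξ : X → ι),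
        Measurable ξ → (∀ x y, ξ x = ξ y → dist x y ≤ ε) → ∀ q : ℕ,
        q * r ≤ partitionEntropy μ (itinerary f ξ q) + q * ∫ x, φ x ∂(μ : Measure X) +
            q * (q * log (Fintype.card ι)) / n := by
    rintro n ⟨hn, hrn⟩
    obtain ⟨F, hF, hne, hle⟩ := exists_le_log_sum_exp hn hrn
    obtain ⟨μ, h1, h2⟩ := exists_almostInvariant hf φ hn hF hne
    exact ⟨μ, h1, fun ξ hξ hd q =>
      (mul_le_mul_of_nonneg_left hle q.cast_nonneg).trans (h2 ξ hξ hd q)⟩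
  obtain ⟨n₀, hn₀⟩ := hN.exists
  have : Nonempty (ProbabilityMeasure X) := ⟨(hex n₀ hn₀).choose⟩
  choose! μs hinv hent using hex
  have : NeBot (atTop ⊓ 𝓟 N) := frequently_mem_iff_neBot.1 hN
  -- An ultrafilter on the good times `N` replaces the choice of a convergent subsequence.
  let U : Ultrafilter ℕ := Ultrafilter.of (atTop ⊓ 𝓟 N)
  have hU : (U : Filter ℕ) ≤ atTop := (Ultrafilter.of_le _).trans inf_le_left
  have hUN : ∀ᶠ n in U, n ∈ N := (Ultrafilter.of_le _).trans inf_le_right (mem_principal_self N)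
  obtain ⟨μ, hμ⟩ : ∃ μ, Tendsto μs U (𝓝 μ) := ⟨(U.map μs).lim, (U.map μs).le_nhds_lim⟩
  have hlim : ∀ g : C(X, ℝ), Tendsto (fun n => ∫ x, g x ∂(μs n : Measure X)) U
      (𝓝 (∫ x, g x ∂(μ : Measure X))) := fun g =>
    ((ProbabilityMeasure.continuous_integral_continuousMap g).tendsto μ).comp hμ
  have hdiv : ∀ c : ℝ, Tendsto (fun n : ℕ => c / n) U (𝓝 0) := fun c =>
    (tendsto_const_div_atTop_nhds_zero_nat c).mono_left hU
  have hμinv : μ ∈ invariantMeasures f := by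
    refine mem_invariantMeasures_of_integral hf fun g => sub_eq_zero.1 ?_
    have h1 := ((hlim (g.comp ⟨f, hf⟩)).sub (hlim g))
    refine tendsto_nhds_unique h1 ?_
    exact squeeze_zero_norm' (hUN.mono fun n hn => hinv n hn g) (hdiv _)
  refine ⟨μ, hμinv, ?_⟩
  -- Null boundaries for the limit measure `μ` make the entropies of itineraries of fixed length `q`
  -- converge along `U`.
  obtain ⟨k, ξ, hξ, hd, hξ0⟩ := exists_partition_null_frontier (μ : Measure X) hε
  have hit0 : ∀ q, ∀ c, (μ : Measure X) (frontier (itinerary f ξ q ⁻¹' {c})) = 0 := by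
    intro q c
    have : itinerary f ξ q ⁻¹' {c} = ⋂ j : Fin q, f^[j] ⁻¹' (ξ ⁻¹' {c j}) := by
      ext x
      simp [itinerary, funext_iff]
    rw [this]
    exact null_frontier_iInter fun j =>
      null_frontier_preimage (hf.iterate j) (hμinv.iterate j) (hξ0 _)
  have hq : ∀ q : ℕ, q * r ≤
      partitionEntropy μ (itinerary f ξ q) + q * ∫ x, φ x ∂(μ : Measure X) := by
    intro q
    have h1 := ((tendsto_partitionEntropy hμ (hit0 q)).add ((hlim φ).const_mul (q : ℝ))).add
      (hdiv (q * (q * log (Fintype.card (Fin k → Bool)))))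
    rw [add_zero] at h1
    exact ge_of_tendsto h1 (hUN.mono fun n hn => hent n hn ξ hξ hd q)
  have hle : ((r - ∫ x, φ x ∂(μ : Measure X) : ℝ) : EReal) ≤ metricEntropy f μ := by
    refine le_trans ?_ (entropyOfPartition_le_metricEntropy μ hf.measurable hξ)
    refine le_limsup_of_frequently_le (Eventually.frequently ?_) (by isBoundedDefault)
    filter_upwards [eventually_gt_atTop 0] with q hq0
    have hq0' : (0 : ℝ) < q := by exact_mod_cast hq0
    rw [EReal.coe_le_coe_iff, le_div_iff₀ hq0']
    linarith [hq q]
  calc (r : EReal) = ((r - ∫ x, φ x ∂(μ : Measure X) : ℝ) : EReal) +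
        ((∫ x, φ x ∂(μ : Measure X) : ℝ) : EReal) := by rw [← EReal.coe_add, sub_add_cancel]
    _ ≤ _ := add_le_add hle le_rfl

end LowerBound

/-! ### Non-ergodic measures and convexity of entropy -/

section Decomposition

variable {X : Type*} [MeasurableSpace X]

/-- Condition `μ` on an invariant set of intermediate measure and on its complement; each
conditional measure misses a set charged by `μ`. -/
theorem exists_decomposition_of_not_ergodic {f : X → X} {μ : ProbabilityMeasure X}
    (hμ : μ ∈ invariantMeasures f) (hne : μ ∉ ergodicMeasures f) :
    ∃ ν₁ ∈ invariantMeasures f, ∃ ν₂ ∈ invariantMeasures f, ν₁ ≠ μ ∧ ν₂ ≠ μ ∧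
      ∃ a b : ℝ, 0 < a ∧ 0 < b ∧ a + b = 1 ∧
        (μ : Measure X) = ENNReal.ofReal a • (ν₁ : Measure X) + ENNReal.ofReal b • ν₂ := by
  have hμ' : MeasurePreserving f (μ : Measure X) μ := hμ
  obtain ⟨A, hA, hfA, hconst⟩ : ∃ A, MeasurableSet A ∧ f ⁻¹' A = A ∧
      ¬ EventuallyConst A (ae (μ : Measure X)) := by
    by_contra! h
    exact hne ⟨hμ', ⟨fun s hs hfs => h s hs hfs⟩⟩
  rw [eventuallyConst_set] at hconst
  push Not at hconst
  obtain ⟨h1, h2⟩ := hconst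
  have hA0 : (μ : Measure X) A ≠ 0 := fun h => h2 (measure_eq_zero_iff_ae_notMem.1 h)
  have hAc0 : (μ : Measure X) Aᶜ ≠ 0 := fun h => h1 (by
    simpa using measure_eq_zero_iff_ae_notMem.1 h)
  have key : ∀ B, MeasurableSet B → f ⁻¹' B = B → (μ : Measure X) B ≠ 0 →
      (μ : Measure X) Bᶜ ≠ 0 → ∃ ν ∈ invariantMeasures f, ν ≠ μ ∧
        (μ : Measure X) B • (ν : Measure X) = (μ : Measure X).restrict B := by
    intro B hB hfB hB0 hBc0
    have := ProbabilityTheory.cond_isProbabilityMeasure hB0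
    refine ⟨⟨ProbabilityTheory.cond (μ : Measure X) B, this⟩, ?_, ?_, ?_⟩
    · have := hμ'.restrict_preimage hB
      rw [hfB] at this
      exact this.smul_measure _
    · intro h
      have h3 : ProbabilityTheory.cond (μ : Measure X) B Bᶜ = (μ : Measure X) Bᶜ := by
        conv_rhs => rw [← h]
        rfl
      rw [ProbabilityTheory.cond_apply hB] at h3
      simp at h3
      exact hBc0 (by simpa using h3.symm)
    · change (μ : Measure X) B • (((μ : Measure X) B)⁻¹ • (μ : Measure X).restrict B) = _
      rw [smul_smul, ENNReal.mul_inv_cancel hB0 (measure_ne_top _ _), one_smul]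
  obtain ⟨ν₁, hν₁, hne₁, e₁⟩ := key A hA hfA hA0 hAc0
  obtain ⟨ν₂, hν₂, hne₂, e₂⟩ := key Aᶜ hA.compl (by rw [Set.preimage_compl, hfA]) hAc0
    (by rwa [compl_compl])
  refine ⟨ν₁, hν₁, ν₂, hν₂, hne₁, hne₂, (μ : Measure X).real A, (μ : Measure X).real Aᶜ,
    ENNReal.toReal_pos hA0 (measure_ne_top _ _), ENNReal.toReal_pos hAc0 (measure_ne_top _ _),
    probReal_add_probReal_compl hA, ?_⟩
  rw [ofReal_measureReal, ofReal_measureReal, e₁, e₂, Measure.restrict_add_restrict_compl hA]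

/-- The additive constant in the convexity of partition entropy vanishes after division by `n`. Real
upper bounds `c₁`, `c₂` avoid arithmetic with infinite entropies. -/
theorem metricEntropy_le_of_eq_add {f : X → X} (hf : Measurable f) {μ ν₁ ν₂ : ProbabilityMeasure X}
    {a b : ℝ} (ha : 0 ≤ a) (hb : 0 ≤ b)
    (h : (μ : Measure X) = ENNReal.ofReal a • (ν₁ : Measure X) + ENNReal.ofReal b • ν₂)
    {c₁ c₂ : ℝ} (h₁ : metricEntropy f ν₁ < c₁) (h₂ : metricEntropy f ν₂ < c₂) :
    metricEntropy f μ ≤ ((a * c₁ + b * c₂ : ℝ) : EReal) := by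
  have hreal : ∀ s, MeasurableSet s →
      (μ : Measure X).real s = a * (ν₁ : Measure X).real s + b * (ν₂ : Measure X).real s := by
    intro s _
    have hfin : ∀ (c : ℝ) (ν : ProbabilityMeasure X), (ENNReal.ofReal c • (ν : Measure X)) s ≠ ⊤ :=
      fun c ν => ENNReal.mul_ne_top ENNReal.ofReal_ne_top (measure_ne_top _ _)
    rw [h, measureReal_add_apply (hfin _ _) (hfin _ _)]
    simp [ENNReal.toReal_ofReal ha, ENNReal.toReal_ofReal hb]
  refine iSup₂_le fun k ξ => iSup_le fun hξ => ?_
  have hlt : ∀ {ν : ProbabilityMeasure X} {c : ℝ}, metricEntropy f ν < c →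
      ∀ᶠ n : ℕ in atTop, partitionEntropy ν (itinerary f ξ n) / n < c := by
    intro ν c hν
    have := (entropyOfPartition_le_metricEntropy ν hf hξ).trans_lt hν
    filter_upwards [eventually_lt_of_limsup_lt this] with n hn
    exact EReal.coe_lt_coe_iff.1 hn
  refine EReal.le_of_forall_lt_iff_le.1 fun r hr => ?_
  rw [EReal.coe_lt_coe_iff] at hr
  have hC : ∀ᶠ n : ℕ in atTop, (negMulLog a + negMulLog b) / n < r - (a * c₁ + b * c₂) :=
    (tendsto_const_div_atTop_nhds_zero_nat _).eventually_lt_const (by linarith)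
  refine limsup_le_of_le (by isBoundedDefault) ?_
  filter_upwards [hlt h₁, hlt h₂, hC, eventually_gt_atTop 0] with n h1 h2 h3 hn0
  have hn : (0 : ℝ) < n := by exact_mod_cast hn0
  rw [EReal.coe_le_coe_iff]
  have hH := div_le_div_of_nonneg_right
    (partitionEntropy_le_convexCombination ha hb (measurable_itinerary hf hξ n) hreal) hn.le
  rw [add_div, add_div, mul_div_assoc, mul_div_assoc] at hH
  have h4 := mul_le_mul_of_nonneg_left h1.le ha
  have h5 := mul_le_mul_of_nonneg_left h2.le hb
  linarith

end Decomposition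

/-! ### Equilibrium states: existence, closedness, ergodic elements -/

section Equilibrium

variable {X : Type*} [MetricSpace X] [MeasurableSpace X]

theorem coe_le_measurePressure_iff {f : X → X} {φ : C(X, ℝ)} {μ : ProbabilityMeasure X} {r : ℝ} :
    (r : EReal) ≤ measurePressure f φ μ ↔
      ((r - ∫ x, φ x ∂(μ : Measure X) : ℝ) : EReal) ≤ metricEntropy f μ := by
  unfold measurePressure
  induction metricEntropy f μ with
  | bot => simp only [EReal.bot_add, le_bot_iff, EReal.coe_ne_bot]
  | coe x => rw [← EReal.coe_add, EReal.coe_le_coe_iff, EReal.coe_le_coe_iff, sub_le_iff_le_add]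
  | top => simp

theorem measurePressure_le_coe_iff {f : X → X} {φ : C(X, ℝ)} {μ : ProbabilityMeasure X} {r : ℝ} :
    measurePressure f φ μ ≤ r ↔
      metricEntropy f μ ≤ ((r - ∫ x, φ x ∂(μ : Measure X) : ℝ) : EReal) := by
  unfold measurePressure
  induction metricEntropy f μ with
  | bot => simp
  | coe x => rw [← EReal.coe_add, EReal.coe_le_coe_iff, EReal.coe_le_coe_iff, le_sub_iff_add_le]
  | top => simp only [EReal.top_add_coe, top_le_iff, EReal.coe_ne_top]

theorem measurePressure_eq_coe_iff {f : X → X} {φ : C(X, ℝ)} {μ : ProbabilityMeasure X} {r : ℝ} :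
    measurePressure f φ μ = r ↔
      metricEntropy f μ = ((r - ∫ x, φ x ∂(μ : Measure X) : ℝ) : EReal) := by
  rw [le_antisymm_iff, le_antisymm_iff, measurePressure_le_coe_iff, coe_le_measurePressure_iff]

theorem measurePressure_eq_top_iff {f : X → X} {φ : C(X, ℝ)} {μ : ProbabilityMeasure X} :
    measurePressure f φ μ = ⊤ ↔ metricEntropy f μ = ⊤ := by
  unfold measurePressure
  induction metricEntropy f μ with
  | bot => simp
  | coe x => simp [← EReal.coe_add]
  | top => simp

theorem measurePressure_ne_bot (f : X → X) (φ : C(X, ℝ)) (μ : ProbabilityMeasure X) :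
    measurePressure f φ μ ≠ ⊥ := by
  intro h
  have := coe_le_measurePressure_iff.2
    (show ((∫ x, φ x ∂(μ : Measure X) - ∫ x, φ x ∂(μ : Measure X) : ℝ) : EReal) ≤
      metricEntropy f μ by simpa using metricEntropy_nonneg μ f)
  rw [h] at this
  exact absurd (le_bot_iff.1 this) (EReal.coe_ne_bot _)

/-- Entropy is eliminated here: what remains depends on `μ` through integrals of continuous
functions only. -/
theorem measurePressure_eq_of_mem {f : X → X} {φ ψ : C(X, ℝ)} {p : ℝ}
    (hp : topPressure f φ = p) {μ : ProbabilityMeasure X} (hμ : μ ∈ equilibriumStates f φ) :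
    measurePressure f ψ μ =
      ((p - ∫ x, φ x ∂(μ : Measure X) + ∫ x, ψ x ∂(μ : Measure X) : ℝ) : EReal) := by
  rw [measurePressure_eq_coe_iff, measurePressure_eq_coe_iff.1 (hμ.2.trans hp), add_sub_cancel_right]

theorem measurePressure_zero (f : X → X) (μ : ProbabilityMeasure X) :
    measurePressure f 0 μ = metricEntropy f μ := by
  simp [measurePressure]

variable [BorelSpace X]

theorem isClosed_invariantMeasures {f : X → X} (hf : Continuous f) :
    IsClosed (invariantMeasures f) := by
  have : invariantMeasures f =
      {μ : ProbabilityMeasure X | μ.map hf.measurable.aemeasurable = μ} := by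
    ext μ
    refine ⟨fun h => Subtype.ext h.map_eq, fun h => ⟨hf.measurable, congrArg Subtype.val h⟩⟩
  rw [this]
  exact isClosed_eq (ProbabilityMeasure.continuous_map hf) continuous_id

variable [CompactSpace X]

/-- An upper semi-continuous function attains its maximum on the compact set of invariant measures,
and the variational principle says that this maximum is the pressure. -/
theorem exists_equilibriumState {f : X → X} (hf : Continuous f) (husc : IsUSCSystem f)
    (hne : (invariantMeasures f).Nonempty) (φ : C(X, ℝ)) : (equilibriumStates f φ).Nonempty := by
  have hcont : Continuous fun μ : ProbabilityMeasure X =>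
      ((∫ x, φ x ∂(μ : Measure X) : ℝ) : EReal) :=
    continuous_coe_real_ereal.comp (ProbabilityMeasure.continuous_integral_continuousMap φ)
  have hU : UpperSemicontinuousOn (measurePressure f φ) (invariantMeasures f) :=
    UpperSemicontinuousOn.add' husc (hcont.upperSemicontinuous.upperSemicontinuousOn _)
      fun μ _ => EReal.continuousAt_add (Or.inr (EReal.coe_ne_bot _)) (Or.inr (EReal.coe_ne_top _))
  obtain ⟨μ, hμ, hmax⟩ := hU.exists_isMaxOn hne (isClosed_invariantMeasures hf).isCompact
  refine ⟨μ, hμ, le_antisymm (measurePressure_le_topPressure hf hμ φ) ?_⟩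
  refine EReal.ge_of_forall_gt_iff_ge.1 fun r hr => ?_
  obtain ⟨ν, hν, hle⟩ := exists_le_measurePressure hf hr
  exact hle.trans (hmax hν)

theorem abs_integral_sub_le (φ₁ φ₂ : C(X, ℝ)) (μ : ProbabilityMeasure X) :
    |∫ x, φ₁ x ∂(μ : Measure X) - ∫ x, φ₂ x ∂(μ : Measure X)| ≤ ‖φ₁ - φ₂‖ := by
  rw [← integral_sub (integrable_continuousMap φ₁ μ) (integrable_continuousMap φ₂ μ)]
  have := norm_integral_le_of_norm_le_const (μ := (μ : Measure X))
    (f := fun x => φ₁ x - φ₂ x) (C := ‖φ₁ - φ₂‖)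
    (Eventually.of_forall fun x => (φ₁ - φ₂).norm_coe_le_norm x)
  simpa using this

theorem tendsto_integral {α : Type*} {L : Filter α} {μs : α → ProbabilityMeasure X}
    {μ : ProbabilityMeasure X} {φs : α → C(X, ℝ)} {φ : C(X, ℝ)} (hμ : Tendsto μs L (𝓝 μ))
    (hφ : Tendsto φs L (𝓝 φ)) :
    Tendsto (fun a => ∫ x, φs a x ∂(μs a : Measure X)) L (𝓝 (∫ x, φ x ∂(μ : Measure X))) := by
  have h1 := ((ProbabilityMeasure.continuous_integral_continuousMap φ).tendsto μ).comp hμ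
  have h2 : Tendsto (fun a => ∫ x, φs a x ∂(μs a : Measure X) - ∫ x, φ x ∂(μs a : Measure X)) L
      (𝓝 0) := squeeze_zero_norm (fun a => abs_integral_sub_le _ _ _)
        (tendsto_iff_norm_sub_tendsto_zero.1 hφ)
  simpa using h2.add h1

/-- Upper semi-continuity of the pressure, jointly in the measure and the potential. -/
theorem le_measurePressure_of_tendsto {f : X → X} (hf : Continuous f) (husc : IsUSCSystem f)
    {α : Type*} {L : Filter α} [NeBot L] {μs : α → ProbabilityMeasure X}
    {μ : ProbabilityMeasure X} {φs : α → C(X, ℝ)} {φ : C(X, ℝ)} {ps : α → ℝ} {p : ℝ}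
    (hμ : Tendsto μs L (𝓝 μ)) (hφ : Tendsto φs L (𝓝 φ)) (hp : Tendsto ps L (𝓝 p))
    (hinv : ∀ᶠ a in L, μs a ∈ invariantMeasures f)
    (hle : ∀ᶠ a in L, (ps a : EReal) ≤ measurePressure f (φs a) (μs a)) :
    μ ∈ invariantMeasures f ∧ (p : EReal) ≤ measurePressure f φ μ := by
  have hμinv := (isClosed_invariantMeasures hf).mem_of_tendsto hμ hinv
  refine ⟨hμinv, ?_⟩
  rw [coe_le_measurePressure_iff]
  by_contra! hlt
  obtain ⟨b, hb1, hb2⟩ := EReal.lt_iff_exists_real_btwn.1 hlt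
  rw [EReal.coe_lt_coe_iff] at hb2
  have h1 := (tendsto_nhdsWithin_iff.2 ⟨hμ, hinv⟩).eventually
    (husc μ hμinv b hb1)
  have h2 := (hp.sub (tendsto_integral hμ hφ)).eventually_const_lt hb2
  obtain ⟨a, ha1, ha2, ha3⟩ := (h1.and (h2.and hle)).exists
  have h3 := (coe_le_measurePressure_iff.1 ha3).trans_lt ha1
  rw [EReal.coe_lt_coe_iff] at h3
  exact absurd ha2 h3.not_gt

theorem isClosed_equilibriumStates {f : X → X} (hf : Continuous f) (husc : IsUSCSystem f)
    {φ : C(X, ℝ)} {p : ℝ} (hp : topPressure f φ = p) : IsClosed (equilibriumStates f φ) := by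
  refine isClosed_iff_ultrafilter.2 fun μ U hU hmem => ?_
  obtain ⟨h1, h2⟩ := le_measurePressure_of_tendsto hf husc (L := (U : Filter _)) (μs := id)
    (φs := fun _ => φ) (ps := fun _ => p) (tendsto_id'.2 hU) tendsto_const_nhds tendsto_const_nhds
    (Filter.mem_of_superset hmem fun ν hν => hν.1)
    (Filter.mem_of_superset hmem fun ν hν => (hν.2.trans hp).ge)
  exact ⟨h1, le_antisymm (measurePressure_le_topPressure hf h1 φ) (hp.trans_le h2)⟩

theorem integral_eq_of_eq_add {μ ν₁ ν₂ : ProbabilityMeasure X} {a b : ℝ} (ha : 0 ≤ a)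
    (hb : 0 ≤ b)
    (h : (μ : Measure X) = ENNReal.ofReal a • (ν₁ : Measure X) + ENNReal.ofReal b • ν₂)
    (φ : C(X, ℝ)) :
    ∫ x, φ x ∂(μ : Measure X) =
      a * ∫ x, φ x ∂(ν₁ : Measure X) + b * ∫ x, φ x ∂(ν₂ : Measure X) := by
  rw [h, integral_add_measure ((integrable_continuousMap φ ν₁).smul_measure ENNReal.ofReal_ne_top)
    ((integrable_continuousMap φ ν₂).smul_measure ENNReal.ofReal_ne_top),
    integral_smul_measure, integral_smul_measure, ENNReal.toReal_ofReal ha,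
    ENNReal.toReal_ofReal hb, smul_eq_mul, smul_eq_mul]

/-- The equilibrium states form a face of the set of invariant measures. -/
theorem mem_equilibriumStates_of_eq_add {f : X → X} (hf : Continuous f) {φ : C(X, ℝ)} {p : ℝ}
    (hp : topPressure f φ = p) {μ ν₁ ν₂ : ProbabilityMeasure X} (hμ : μ ∈ equilibriumStates f φ)
    (h₁ : ν₁ ∈ invariantMeasures f) (h₂ : ν₂ ∈ invariantMeasures f) {a b : ℝ} (ha : 0 < a)
    (hb : 0 < b) (hab : a + b = 1)
    (h : (μ : Measure X) = ENNReal.ofReal a • (ν₁ : Measure X) + ENNReal.ofReal b • ν₂) :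
    ν₁ ∈ equilibriumStates f φ := by
  by_contra hν₁
  have hle₁ := measurePressure_le_topPressure hf h₁ φ
  have hle₂ := measurePressure_le_topPressure hf h₂ φ
  have hnot : ¬ (p : EReal) ≤ measurePressure f φ ν₁ := fun hge =>
    hν₁ ⟨h₁, le_antisymm hle₁ (hp.trans_le hge)⟩
  rw [coe_le_measurePressure_iff, not_le] at hnot
  obtain ⟨c, hc1, hc2⟩ := EReal.lt_iff_exists_real_btwn.1 hnot
  rw [EReal.coe_lt_coe_iff] at hc2
  rw [hp, measurePressure_le_coe_iff] at hle₂
  set I₁ := ∫ x, φ x ∂(ν₁ : Measure X)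
  set I₂ := ∫ x, φ x ∂(ν₂ : Measure X)
  -- Half the weighted deficit of `ν₁`: the slack `b * δ` granted to `ν₂` cannot make up for it.
  set δ := a * (p - I₁ - c) / 2 with hδ
  have hδ0 : 0 < δ := by
    have : 0 < p - I₁ - c := by linarith
    positivity
  have h3 : metricEntropy f ν₂ < ((p - I₂ + δ : ℝ) : EReal) :=
    hle₂.trans_lt (EReal.coe_lt_coe_iff.2 (by linarith))
  have h4 := metricEntropy_le_of_eq_add hf.measurable ha.le hb.le h hc1 h3
  rw [(measurePressure_eq_coe_iff.1 (hμ.2.trans hp)), EReal.coe_le_coe_iff,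
    integral_eq_of_eq_add ha.le hb.le h φ] at h4
  have h5 : b * δ ≤ δ := by nlinarith
  have h6 : b = 1 - a := by linarith
  subst h6
  nlinarith

/-- With finite pressure this is the face property. With infinite pressure every invariant measure
of infinite entropy is an equilibrium state, so both components would have finite entropy, and by
convexity so would `μ`. -/
theorem ergodic_of_unique {f : X → X} (hf : Continuous f) {φ : C(X, ℝ)}
    {μ : ProbabilityMeasure X} (hμ : μ ∈ equilibriumStates f φ)
    (huniq : ∀ ν ∈ equilibriumStates f φ, ν = μ) : μ ∈ ergodicMeasures f := by
  by_contra hne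
  obtain ⟨ν₁, h₁, ν₂, h₂, hne₁, hne₂, a, b, ha, hb, hab, h⟩ :=
    exists_decomposition_of_not_ergodic hμ.1 hne
  rcases eq_or_ne (topPressure f φ) ⊤ with hp | hp
  · have hlt : ∀ ν ∈ invariantMeasures f, ν ≠ μ → metricEntropy f ν < ⊤ := by
      intro ν hν hνμ
      refine lt_top_iff_ne_top.2 fun hν' => hνμ (huniq ν ⟨hν, ?_⟩)
      rw [hp, measurePressure_eq_top_iff, hν']
    obtain ⟨c₁, hc₁, -⟩ := EReal.lt_iff_exists_real_btwn.1 (hlt ν₁ h₁ hne₁)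
    obtain ⟨c₂, hc₂, -⟩ := EReal.lt_iff_exists_real_btwn.1 (hlt ν₂ h₂ hne₂)
    have := metricEntropy_le_of_eq_add hf.measurable ha.le hb.le h hc₁ hc₂
    rw [measurePressure_eq_top_iff.1 (hμ.2.trans hp)] at this
    exact absurd (top_le_iff.1 this) (EReal.coe_ne_top _)
  · have hb' : topPressure f φ ≠ ⊥ := hμ.2 ▸ measurePressure_ne_bot f φ μ
    exact hne₁ (huniq _ (mem_equilibriumStates_of_eq_add hf (EReal.coe_toReal hp hb').symm hμ
      h₁ h₂ ha hb hab h))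

theorem exists_ergodic_equilibriumState {f : X → X} (hf : Continuous f) (husc : IsUSCSystem f)
    {φ : C(X, ℝ)} {p : ℝ} (hp : topPressure f φ = p) (hne : (equilibriumStates f φ).Nonempty) :
    ∃ μ ∈ equilibriumStates f φ, μ ∈ ergodicMeasures f := by
  -- Integration embeds the measures in a locally convex product space, where a nonempty compact set
  -- has an extreme point.
  let Λ : ProbabilityMeasure X → (C(X, ℝ) → ℝ) := fun μ g => ∫ x, g x ∂(μ : Measure X)
  have hΛ : Continuous Λ :=
    continuous_pi fun g => ProbabilityMeasure.continuous_integral_continuousMap g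
  have hinj : Function.Injective Λ := fun μ ν h =>
    Subtype.ext (ext_of_forall_integral_eq_of_IsFiniteMeasure (μ := (μ : Measure X))
      (ν := (ν : Measure X)) fun g =>
      congrFun h g.toContinuousMap)
  have hK : IsCompact (Λ '' equilibriumStates f φ) :=
    (isClosed_equilibriumStates hf husc hp).isCompact.image hΛ
  obtain ⟨_, ⟨μ, hμ, rfl⟩, hext⟩ := hK.extremePoints_nonempty (hne.image Λ)
  refine ⟨μ, hμ, ?_⟩
  by_contra hnerg
  obtain ⟨ν₁, h₁, ν₂, h₂, hne₁, -, a, b, ha, hb, hab, h⟩ :=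
    exists_decomposition_of_not_ergodic hμ.1 hnerg
  have e₁ := mem_equilibriumStates_of_eq_add hf hp hμ h₁ h₂ ha hb hab h
  have e₂ := mem_equilibriumStates_of_eq_add hf hp hμ h₂ h₁ hb ha (by rw [add_comm, hab])
    (by rw [h, add_comm])
  refine hne₁ (hinj (hext ⟨ν₁, e₁, rfl⟩ ⟨ν₂, e₂, rfl⟩ ⟨a, b, ha, hb, hab, ?_⟩))
  ext g
  exact (integral_eq_of_eq_add ha.le hb.le h g).symm

end Equilibrium

/-! ### Continuity along paths and intermediate values -/

section IntermediateValues

variable {X : Type*} [MetricSpace X] [MeasurableSpace X] [BorelSpace X] [CompactSpace X]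

/-- Infinite pressure is attained by a measure of infinite entropy, which then has infinite pressure
for every potential. -/
theorem topPressure_ne_top_of_ne_top {f : X → X} (hf : Continuous f) (husc : IsUSCSystem f)
    (hne : (invariantMeasures f).Nonempty) {φ₀ : C(X, ℝ)} (h₀ : topPressure f φ₀ ≠ ⊤)
    (φ : C(X, ℝ)) : topPressure f φ ≠ ⊤ := by
  obtain ⟨μ, hμ⟩ := exists_equilibriumState hf husc hne φ
  intro htop
  have h1 : measurePressure f φ₀ μ = ⊤ :=
    measurePressure_eq_top_iff.2 (measurePressure_eq_top_iff.1 (hμ.2.trans htop))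
  exact h₀ (top_le_iff.1 (h1 ▸ measurePressure_le_topPressure hf hμ.1 φ₀))

/-- An equilibrium state of one potential is a competitor for the other. -/
theorem abs_topPressure_sub_le {f : X → X} (hf : Continuous f) (husc : IsUSCSystem f)
    (hne : (invariantMeasures f).Nonempty) {p : C(X, ℝ) → ℝ} (hp : ∀ φ, topPressure f φ = p φ)
    (φ₁ φ₂ : C(X, ℝ)) : |p φ₁ - p φ₂| ≤ ‖φ₁ - φ₂‖ := by
  have key : ∀ φ₁ φ₂ : C(X, ℝ), p φ₁ - p φ₂ ≤ ‖φ₁ - φ₂‖ := by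
    intro φ₁ φ₂
    obtain ⟨μ, hμ⟩ := exists_equilibriumState hf husc hne φ₁
    have h1 := measurePressure_eq_coe_iff.1 (hμ.2.trans (hp φ₁))
    have h2 := measurePressure_le_topPressure hf hμ.1 φ₂
    rw [hp, measurePressure_le_coe_iff, h1, EReal.coe_le_coe_iff] at h2
    have h3 := (abs_le.1 (abs_integral_sub_le φ₁ φ₂ μ)).2
    linarith
  refine abs_le.2 ⟨?_, key φ₁ φ₂⟩
  have := key φ₂ φ₁
  rw [norm_sub_rev] at this
  linarith

theorem Icc_subset_pressureSpectrum {f : X → X} (hf : Continuous f) (husc : IsUSCSystem f)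
    {ψ : C(X, ℝ)} {T : ℝ} (hT : 0 ≤ T) {Φ : ℝ → C(X, ℝ)} (hΦ : ContinuousOn Φ (Set.Icc 0 T))
    (hmem : ∀ t ∈ Set.Icc 0 T, Φ t ∈ constPressure f ψ)
    (hlt : constPressureValue f ψ (Φ 0) < constPressureValue f ψ (Φ T)) :
    Set.Icc (constPressureValue f ψ (Φ 0)) (constPressureValue f ψ (Φ T)) ⊆
      pressureSpectrum f ψ := by
  have hne : (invariantMeasures f).Nonempty := by
    obtain ⟨μ, hμ⟩ := lt_iSup_iff.1 hlt
    obtain ⟨hμ, -⟩ := lt_iSup_iff.1 hμ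
    exact ⟨μ, hμ.1⟩
  have h0 : (0 : ℝ) ∈ Set.Icc 0 T := ⟨le_rfl, hT⟩
  have hT' : T ∈ Set.Icc 0 T := ⟨hT, le_rfl⟩
  -- Infinite pressure would make the left endpoint `⊤`, against the strict inequality.
  have hfin : topPressure f (Φ 0) ≠ ⊤ := by
    intro htop
    obtain ⟨μ, hμ⟩ := exists_equilibriumState hf husc hne (Φ 0)
    rw [constPressureValue_eq (hmem 0 h0) hμ, measurePressure_eq_top_iff.2
      (measurePressure_eq_top_iff.1 (hμ.2.trans htop))] at hlt
    exact not_top_lt hlt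
  have hp : ∃ p : C(X, ℝ) → ℝ, ∀ φ, topPressure f φ = p φ := by
    refine ⟨fun φ => (topPressure f φ).toReal, fun φ => (EReal.coe_toReal
      (topPressure_ne_top_of_ne_top hf husc hne hfin φ) ?_).symm⟩
    obtain ⟨μ, hμ⟩ := exists_equilibriumState hf husc hne φ
    exact hμ.2 ▸ measurePressure_ne_bot f φ μ
  obtain ⟨p, hp⟩ := hp
  have hpc : Continuous p := by
    refine (LipschitzWith.of_dist_le_mul (K := 1) fun φ₁ φ₂ => ?_).continuous
    simpa [dist_eq_norm] using abs_topPressure_sub_le hf husc hne hp φ₁ φ₂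
  choose μ hμ using fun t => exists_equilibriumState hf husc hne (Φ t)
  let v : ℝ → ℝ := fun t =>
    p (Φ t) - ∫ x, Φ t x ∂(μ t : Measure X) + ∫ x, ψ x ∂(μ t : Measure X)
  have hv : ∀ t ∈ Set.Icc 0 T, ∀ ν ∈ equilibriumStates f (Φ t), measurePressure f ψ ν = v t := by
    intro t ht ν hν
    rw [← constPressureValue_eq (hmem t ht) hν, constPressureValue_eq (hmem t ht) (hμ t)]
    exact measurePressure_eq_of_mem (hp _) (hμ t)
  -- The choice of `μ t` need not be continuous. A limit `ν` of the `μ s` may differ from `μ t`, but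
  -- it lies in `E(Φ t)`, where `P_μ(ψ)` is constant; so `ν` computes `v t` as well.
  have hvc : ContinuousOn v (Set.Icc 0 T) := by
    intro t ht
    refine tendsto_iff_ultrafilter _ _ _ |>.2 fun U hU => ?_
    have hΦU : Tendsto Φ U (𝓝 (Φ t)) := (hΦ t ht).mono_left hU
    have hpU : Tendsto (fun s => p (Φ s)) U (𝓝 (p (Φ t))) := (hpc.tendsto _).comp hΦU
    obtain ⟨ν, hν⟩ : ∃ ν, Tendsto μ U (𝓝 ν) := ⟨(U.map μ).lim, (U.map μ).le_nhds_lim⟩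
    obtain ⟨hνinv, hνle⟩ := le_measurePressure_of_tendsto hf husc hν hΦU hpU
      (Eventually.of_forall fun s => (hμ s).1)
      (Eventually.of_forall fun s => ((hμ s).2.trans (hp _)).ge)
    have hνE : ν ∈ equilibriumStates f (Φ t) :=
      ⟨hνinv, le_antisymm (measurePressure_le_topPressure hf hνinv _) ((hp _).trans_le hνle)⟩
    have hval : v t = p (Φ t) - ∫ x, Φ t x ∂(ν : Measure X) + ∫ x, ψ x ∂(ν : Measure X) :=
      EReal.coe_injective ((hv t ht ν hνE).symm.trans (measurePressure_eq_of_mem (hp _) hνE))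
    rw [hval]
    exact (hpU.sub (tendsto_integral hν hΦU)).add (tendsto_integral hν tendsto_const_nhds)
  have hend : ∀ t ∈ Set.Icc 0 T, constPressureValue f ψ (Φ t) = v t := fun t ht =>
    (constPressureValue_eq (hmem t ht) (hμ t)).trans (hv t ht _ (hμ t))
  rw [hend 0 h0, hend T hT']
  intro α hα
  have hα' : ((α.toReal : ℝ) : EReal) = α := EReal.coe_toReal
    (ne_top_of_le_ne_top (EReal.coe_ne_top _) hα.2) (ne_bot_of_le_ne_bot (EReal.coe_ne_bot _) hα.1)
  rw [← hα', Set.mem_Icc, EReal.coe_le_coe_iff, EReal.coe_le_coe_iff] at hα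
  obtain ⟨t, ht, htα⟩ := intermediate_value_Icc hT hvc hα
  obtain ⟨ν, hν, herg⟩ := exists_ergodic_equilibriumState hf husc (hp (Φ t)) ⟨μ t, hμ t⟩
  exact ⟨ν, herg, by rw [hv t ht ν hν, htα, hα']⟩

/-- For distinct entropies take `ψ = 0`. Equal entropies are treated apart, since they may be
infinite and the interval is then a single point. -/
theorem Icc_subset_entropySpectrum {f : X → X} (hf : Continuous f) (husc : IsUSCSystem f)
    {T : ℝ} (hT : 0 ≤ T) {Φ : ℝ → C(X, ℝ)} {μ : ℝ → ProbabilityMeasure X}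
    (hΦ : ContinuousOn Φ (Set.Icc 0 T)) (huniq : ∀ t ∈ Set.Icc 0 T, Φ t ∈ uniqueEquilibrium f)
    (hμ : ∀ t ∈ Set.Icc 0 T, μ t ∈ equilibriumStates f (Φ t))
    (hle : metricEntropy f (μ 0) ≤ metricEntropy f (μ T)) :
    Set.Icc (metricEntropy f (μ 0)) (metricEntropy f (μ T)) ⊆ entropySpectrum f := by
  have h0 : (0 : ℝ) ∈ Set.Icc 0 T := ⟨le_rfl, hT⟩
  have hT' : T ∈ Set.Icc 0 T := ⟨hT, le_rfl⟩
  rcases hle.eq_or_lt with heq | hlt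
  · rw [← heq, Set.Icc_self, Set.singleton_subset_iff]
    exact ⟨μ 0, ergodic_of_unique hf (hμ 0 h0) fun ν hν =>
      (huniq 0 h0).unique hν (hμ 0 h0), rfl⟩
  · have hmem : ∀ t ∈ Set.Icc 0 T, Φ t ∈ constPressure f 0 := fun t ht =>
      ⟨_, fun ν hν => by rw [(huniq t ht).unique hν (hμ t ht)]⟩
    have hval : ∀ t ∈ Set.Icc 0 T, constPressureValue f 0 (Φ t) = metricEntropy f (μ t) :=
      fun t ht => by rw [constPressureValue_eq (hmem t ht) (hμ t ht), measurePressure_zero]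
    have hspec : pressureSpectrum f 0 = entropySpectrum f :=
      Set.image_congr fun ν _ => measurePressure_zero f ν
    have := Icc_subset_pressureSpectrum hf husc hT hΦ hmem (by rwa [hval 0 h0, hval T hT'])
    rwa [hval 0 h0, hval T hT', hspec] at this

end IntermediateValues

end Thermo

theorem mainTheorem5 {X : Type*} [MetricSpace X] [CompactSpace X] [MeasurableSpace X]
    [BorelSpace X] (f : X → X) (hf : Continuous f) (husc : Thermo.IsUSCSystem f) :
    (∀ (ψ : C(X, ℝ)) (T : ℝ) (_ : 0 ≤ T) (Φ : ℝ → C(X, ℝ)),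
      ContinuousOn Φ (Set.Icc 0 T) →
      (∀ t ∈ Set.Icc 0 T, Φ t ∈ Thermo.constPressure f ψ) →
      Thermo.constPressureValue f ψ (Φ 0) < Thermo.constPressureValue f ψ (Φ T) →
      Set.Icc (Thermo.constPressureValue f ψ (Φ 0)) (Thermo.constPressureValue f ψ (Φ T)) ⊆
        Thermo.pressureSpectrum f ψ) ∧
    (∀ (T : ℝ) (_ : 0 ≤ T) (Φ : ℝ → C(X, ℝ)) (μ : ℝ → MeasureTheory.ProbabilityMeasure X),
      ContinuousOn Φ (Set.Icc 0 T) →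
      (∀ t ∈ Set.Icc 0 T, Φ t ∈ Thermo.uniqueEquilibrium f) →
      (∀ t ∈ Set.Icc 0 T, μ t ∈ Thermo.equilibriumStates f (Φ t)) →
      Thermo.metricEntropy f (μ 0) ≤ Thermo.metricEntropy f (μ T) →
      Set.Icc (Thermo.metricEntropy f (μ 0)) (Thermo.metricEntropy f (μ T)) ⊆
        Thermo.entropySpectrum f) := by
  exact ⟨fun _ _ hT _ hΦ hmem hlt => Thermo.Icc_subset_pressureSpectrum hf husc hT hΦ hmem hlt,
    fun _ hT _ _ hΦ huniq hμ hle => Thermo.Icc_subset_entropySpectrum hf husc hT hΦ huniq hμ hle⟩
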